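/- Let $0<\beta_2\le 1\le \beta_1<\infty$. Consider on $(0,1)$ the system $$\partial_t\omega+u\,\partial_x\omega=\frac{\rho}{x},\qquad \partial_t\rho+u\,\partial_x\rho=0,\qquad \omega(\cdot,0)=\omega_0,\quad \rho(\cdot,0)=\rho_0,$$ $$u(x,t)=x\int_{\min(\beta_2x,1)}^{\min(\beta_1x,1)}\frac{\omega(y,t)}{y}\,dy-x\int_{\min(\beta_1x,1)}^{1}\frac{\omega(y,t)}{y}\,dy .$$ For an integer $n\ge 1$ let $K^n=K^n((0,1))$ be the set of $C^n$ functions $f$ with compact support in $(0,1)$, and put $\|f\|_{K^n}=\|f\|_{C^n}+(\min \operatorname{supp} f)^{-1}$ (the last term being $0$ for $f=0$). For an interval $J\ni 0$ let $C(J,K^n)$ be the set of maps $f:J\to K^n$ that are continuous in the $C^n$ norm and along which $\|f(t)\|_{K^n}$ is locally bounded on $J$. Theorem. For all nonnegative functions $\omega_0,\rho_0$ there is $T=T(\omega_0,\rho_0)>0$ (depending also on the fixed parameters $\beta_1,\beta_2$, but not on $n$) such that, for every integer $n\ge1$ with $(\omega_0,\rho_0)\in K^n\times K^n$, the system has a classical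 solution $(\omega,\rho)\in C([0,T],K^n)\times C([0,T],K^n)$. It is unique: if $J\subseteq[0,T]$ is an interval containing $0$ (for instance $[0,T]$ or $[0,T)$), every classical solution in $C(J,K^n)\times C(J,K^n)$ with the same initial data coincides with $(\omega,\rho)$ on $J$. -/

import Mathlib

open Set Filter Topology

/-- The norm of `C^n`: the sum over `k ≤ n` of the suprema of the `k`-th derivatives.
It is only used for compactly supported functions of class `C^n`, where the suprema are finite. -/
noncomputable def cnNorm (n : ℕ) (f : ℝ → ℝ) : ℝ :=
  ∑ k ∈ Finset.range (n + 1), ⨆ x : ℝ, |iteratedDeriv k f x|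

/-- The functional `‖f‖_{C^n} + (min supp f)⁻¹`. For `f = 0` the second summand is `0`. -/
noncomputable def kNorm (n : ℕ) (f : ℝ → ℝ) : ℝ :=
  cnNorm n f + (sInf (tsupport f))⁻¹

/-- Membership in `K^n((0,1))`: functions of class `C^n` with compact support in `(0,1)`,
regarded as functions on the line that vanish outside `(0,1)`. -/
structure MemK (n : ℕ) (f : ℝ → ℝ) : Prop where
  contDiff : ContDiff ℝ n f
  hasCompactSupport : HasCompactSupport f
  tsupport_subset : tsupport f ⊆ Ioo 0 1

/-- The class `C(J, K^n((0,1)))` of curves `t ↦ f t` defined for `t ∈ J`: each `f t` is in `K^n`,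
the curve is continuous for the norm of `C^n`, and the `K^n` functional is locally bounded along it
(so that supports stay away from the origin, locally uniformly in time).
The functional is not homogeneous and `t ↦ (min supp (f t))⁻¹` is not required to be continuous:
with `ω₀ = 0` and `ρ₀ ≠ 0` the forcing makes it jump at time `0`. -/
structure ContinuousInK (n : ℕ) (J : Set ℝ) (f : ℝ → ℝ → ℝ) : Prop where
  memK : ∀ t ∈ J, MemK n (f t)
  tendsto : ∀ t ∈ J, Tendsto (fun s => cnNorm n (f s - f t)) (𝓝[J] t) (𝓝 0)
  locallyBounded : ∀ t ∈ J, ∃ M : ℝ, ∀ᶠ s in 𝓝[J] t, kNorm n (f s) ≤ M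

/-- The Biot-Savart law: the velocity at the point `x` generated by the vorticity `w`. -/
noncomputable def velocity (β₁ β₂ : ℝ) (w : ℝ → ℝ) (x : ℝ) : ℝ :=
  x * (∫ y in (min (β₂ * x) 1)..(min (β₁ * x) 1), w y / y)
    - x * ∫ y in (min (β₁ * x) 1)..1, w y / y

/-- `(ω, ρ)`, with `ω t x` the vorticity and `ρ t x` the density at time `t` and position `x`, is a
(classical) solution on the time interval `J` with initial data `(ω₀, ρ₀)`, in the class
`C(J, K^n((0,1))) × C(J, K^n((0,1)))`. Time derivatives are one-sided at end points of `J`. -/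
structure IsSolution (β₁ β₂ : ℝ) (n : ℕ) (ω₀ ρ₀ : ℝ → ℝ) (J : Set ℝ) (ω ρ : ℝ → ℝ → ℝ) :
    Prop where
  continuousInK_vorticity : ContinuousInK n J ω
  continuousInK_density : ContinuousInK n J ρ
  vorticity_equation : ∀ t ∈ J, ∀ x ∈ Ioo (0 : ℝ) 1,
    HasDerivWithinAt (fun s => ω s x)
      (ρ t x / x - velocity β₁ β₂ (ω t) x * deriv (ω t) x) J t
  density_equation : ∀ t ∈ J, ∀ x ∈ Ioo (0 : ℝ) 1,
    HasDerivWithinAt (fun s => ρ s x)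
      (- (velocity β₁ β₂ (ω t) x * deriv (ρ t) x)) J t
  initial_vorticity : ω 0 = ω₀
  initial_density : ρ 0 = ρ₀

/-! In the variable `z = log x` the weight `dy / y` becomes `dz`, the velocity is `u = x v`, and `u
∂ₓ = v ∂_z`. For a vorticity `g` supported in a fixed interval `(c, 0)`, `v` is a combination of
integrals of `g` and `v' = 2 g(z + b₁) - g(z - b₂)`. So `v` is bounded and Lipschitz as soon as `g`
is bounded, and `v'` is exactly as regular as `g`. The system reads `∂ₜg + v ∂_z g = e^{-z} r`, `∂ₜr
+ v ∂_z r = 0`, and both unknowns are explicit once the particle paths `a + D t a` are known.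

Existence is a fixed point problem for the displacement `D` (`exists_isDisplacement_eq_integral`):
for short time the map sending `D` to the integral of its own velocity contracts the bounded,
1/2-Lipschitz displacements. The time is fixed by the support and by the bounds and Lipschitz
constants of the data, hence does not see `n`. Times are clamped to `[0, T]`, so that all objects
live on the whole line.

Regularity needs no theory of differentiable dependence for ODEs. The distance of two particles
solves a scalar linear equation and is therefore an explicit exponential
(`IsFlow.sub_eq_mul_stretch`), which gives the derivatives of the flow and of its inverse. These
formulas gain one derivative over `v'`, and induction reaches order `n` (`IsFlow.contDiffInSpace`).

Uniqueness is a maximum principle (`IsSolution.unique`). At a positive maximum of the difference of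
two solutions, weighted by `exp (-K t)`, the transport term vanishes. The rest is at most a constant
times the maximum, since the support stays away from the origin and the spatial derivatives are
bounded. A large `K` makes this impossible. -/

/-! ### Spatial regularity of time-dependent functions -/

/-- The function `f`, with `f t x` the value at time `t` and position `x`, has spatial derivatives up
to order `n` that are jointly continuous in time and space. -/
def ContDiffInSpace : ℕ → (ℝ → ℝ → ℝ) → Prop
  | 0, f => Continuous fun p : ℝ × ℝ => f p.1 p.2
  | n + 1, f => (Continuous fun p : ℝ × ℝ => f p.1 p.2) ∧
      ∃ f' : ℝ → ℝ → ℝ, (∀ t x, HasDerivAt (f t) (f' t x) x) ∧ ContDiffInSpace n f'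

/-- The mean of `f t` over the segment from `a` to `b`. -/
noncomputable def segmentMean (f : ℝ → ℝ → ℝ) (t a b : ℝ) : ℝ :=
  ∫ θ in (0 : ℝ)..1, f t (a + θ * (b - a))

/-- The point of `[0, T]` nearest to `t`. -/
noncomputable def clampTime (T t : ℝ) : ℝ := max 0 (min t T)

theorem clampTime_nonneg (T t : ℝ) : 0 ≤ clampTime T t := le_max_left _ _

theorem clampTime_le {T : ℝ} (hT : 0 ≤ T) (t : ℝ) : clampTime T t ≤ T :=
  max_le hT (min_le_right _ _)

theorem clampTime_of_mem {T t : ℝ} (ht : t ∈ Icc 0 T) : clampTime T t = t := by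
  rw [clampTime, min_eq_left ht.2, max_eq_right ht.1]

theorem continuous_clampTime (T : ℝ) : Continuous (clampTime T) := by
  unfold clampTime; fun_prop

theorem continuous_integral_of_continuous {X : Type*} [TopologicalSpace X] [FirstCountableTopology X]
    {f : X → ℝ → ℝ} (hf : Continuous fun p : X × ℝ => f p.1 p.2) (a : ℝ) {σ : X → ℝ}
    (hσ : Continuous σ) : Continuous fun x => ∫ s in a..σ x, f x s :=
  intervalIntegral.continuous_parametric_intervalIntegral_of_continuous hf hσ

theorem continuous_segmentMean {f : ℝ → ℝ → ℝ} (hf : Continuous fun p : ℝ × ℝ => f p.1 p.2) :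
    Continuous fun p : ℝ × ℝ × ℝ => segmentMean f p.1 p.2.1 p.2.2 := by
  unfold segmentMean
  refine continuous_integral_of_continuous
    (f := fun p : ℝ × ℝ × ℝ => fun θ => f p.1 (p.2.1 + θ * (p.2.2 - p.2.1))) ?_ 0 continuous_const
  exact hf.comp (f := fun q : (ℝ × ℝ × ℝ) × ℝ =>
    (q.1.1, q.1.2.1 + q.2 * (q.1.2.2 - q.1.2.1))) (by fun_prop)

theorem segmentMean_self (f : ℝ → ℝ → ℝ) (t a : ℝ) : segmentMean f t a a = f t a := by
  simp [segmentMean]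

/-- Hadamard's form of the mean value theorem: the difference quotient becomes a function that is
jointly continuous in time and both end points, also on the diagonal. -/
theorem sub_eq_mul_segmentMean {f f' : ℝ → ℝ → ℝ} (hf : ∀ t x, HasDerivAt (f t) (f' t x) x)
    (hf' : Continuous fun p : ℝ × ℝ => f' p.1 p.2) (t a b : ℝ) :
    f t b - f t a = (b - a) * segmentMean f' t a b := by
  have hline (θ : ℝ) : HasDerivAt (fun θ : ℝ => a + θ * (b - a)) (b - a) θ := by
    simpa using ((hasDerivAt_id θ).mul_const (b - a)).const_add a
  have h := intervalIntegral.integral_eq_sub_of_hasDerivAt (a := 0) (b := 1)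
    (f := fun θ => f t (a + θ * (b - a))) (f' := fun θ => f' t (a + θ * (b - a)) * (b - a))
    (fun θ _ => (hf t _).comp θ (hline θ))
    (Continuous.intervalIntegrable (by
      exact (hf'.comp (f := fun θ : ℝ => (t, a + θ * (b - a))) (by fun_prop)).mul
        continuous_const) _ _)
  rw [intervalIntegral.integral_mul_const] at h
  simp only [one_mul, zero_mul, add_zero, add_sub_cancel] at h
  rw [segmentMean, mul_comm, h]

theorem hasDerivAt_of_sub_eq_mul {F Q : ℝ → ℝ} {a : ℝ} (h : ∀ b, F b - F a = (b - a) * Q b)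
    (hQ : ContinuousAt Q a) : HasDerivAt F (Q a) a := by
  rw [hasDerivAt_iff_tendsto_slope]
  refine (hQ.tendsto.mono_left nhdsWithin_le_nhds).congr' ?_
  filter_upwards [self_mem_nhdsWithin] with b hb
  rw [slope_def_field, h, mul_div_cancel_left₀ _ (sub_ne_zero.2 hb)]

/-- Chain rule in time along a moving point. -/
theorem HasDerivWithinAt.comp_moving {f f' : ℝ → ℝ → ℝ}
    (hf : ∀ t x, HasDerivAt (f t) (f' t x) x)
    (hf' : Continuous fun p : ℝ × ℝ => f' p.1 p.2) {S : Set ℝ} {t c d : ℝ} {A : ℝ → ℝ}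
    (hft : HasDerivWithinAt (fun s => f s (A t)) c S t) (hA : HasDerivWithinAt A d S t) :
    HasDerivWithinAt (fun s => f s (A s)) (c + f' t (A t) * d) S t := by
  rw [hasDerivWithinAt_iff_tendsto_slope] at *
  have hQ : Tendsto (fun s => segmentMean f' s (A t) (A s)) (𝓝[S \ {t}] t) (𝓝 (f' t (A t))) := by
    have hAc : Tendsto A (𝓝[S \ {t}] t) (𝓝 (A t)) := by
      have := (hasDerivWithinAt_iff_tendsto_slope.2 hA).continuousWithinAt
      exact this.tendsto.mono_left (nhdsWithin_mono _ sdiff_subset)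
    rw [← segmentMean_self f' t (A t)]
    exact ((continuous_segmentMean hf').tendsto (t, A t, A t)).comp
      ((tendsto_id.mono_left nhdsWithin_le_nhds).prodMk_nhds (tendsto_const_nhds.prodMk_nhds hAc))
  refine (hft.add (hQ.mul hA)).congr fun s => ?_
  simp only [slope_def_field]
  have := sub_eq_mul_segmentMean hf hf' s (A t) (A s)
  -- The spatial increment is taken at the moving time `s`, so that the time increment is at the
  -- fixed point `A t`, where `hft` applies.
  rw [show f s (A s) - f t (A t) = (f s (A s) - f s (A t)) + (f s (A t) - f t (A t)) by ring, this]
  ring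

namespace ContDiffInSpace

variable {n : ℕ} {f g : ℝ → ℝ → ℝ}

theorem continuous (hf : ContDiffInSpace n f) : Continuous fun p : ℝ × ℝ => f p.1 p.2 := by
  cases n with
  | zero => exact hf
  | succ n => exact hf.1

theorem of_succ (hf : ContDiffInSpace (n + 1) f) : ContDiffInSpace n f := by
  induction n generalizing f with
  | zero => exact hf.1
  | succ n ih =>
    obtain ⟨hc, f', hd, hf'⟩ := hf
    exact ⟨hc, f', hd, ih hf'⟩

theorem add (hf : ContDiffInSpace n f) (hg : ContDiffInSpace n g) :
    ContDiffInSpace n fun t x => f t x + g t x := by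
  induction n generalizing f g with
  | zero => exact Continuous.add hf hg
  | succ n ih =>
    obtain ⟨hc, f', hd, hf'⟩ := hf
    obtain ⟨hc₂, g', hd₂, hg'⟩ := hg
    exact ⟨hc.add hc₂, _, fun t x => (hd t x).add (hd₂ t x), ih hf' hg'⟩

theorem mul (hf : ContDiffInSpace n f) (hg : ContDiffInSpace n g) :
    ContDiffInSpace n fun t x => f t x * g t x := by
  induction n generalizing f g with
  | zero => exact Continuous.mul hf hg
  | succ n ih =>
    have hf₀ := hf.of_succ
    have hg₀ := hg.of_succ
    obtain ⟨hc, f', hd, hf'⟩ := hf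
    obtain ⟨hc₂, g', hd₂, hg'⟩ := hg
    exact ⟨hc.mul hc₂, _, fun t x => (hd t x).mul (hd₂ t x), (ih hf' hg₀).add (ih hf₀ hg')⟩

theorem comp (hf : ContDiffInSpace n f) (hg : ContDiffInSpace n g) :
    ContDiffInSpace n fun t x => f t (g t x) := by
  induction n generalizing f g with
  | zero =>
    exact Continuous.comp (g := fun p : ℝ × ℝ => f p.1 p.2)
      (f := fun p : ℝ × ℝ => (p.1, g p.1 p.2)) hf (continuous_fst.prodMk hg)
  | succ n ih =>
    have hg₀ := hg.of_succ
    obtain ⟨hc, f', hd, hf'⟩ := hf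
    obtain ⟨hc₂, g', hd₂, hg'⟩ := hg
    exact ⟨Continuous.comp (g := fun p : ℝ × ℝ => f p.1 p.2)
      (f := fun p : ℝ × ℝ => (p.1, g p.1 p.2)) hc (continuous_fst.prodMk hc₂), _,
      fun t x => (hd t _).comp x (hd₂ t x), (ih hf' hg₀).mul hg'⟩

theorem of_contDiff {φ : ℝ → ℝ} (h : ContDiff ℝ n φ) : ContDiffInSpace n fun _ => φ := by
  induction n generalizing φ with
  | zero => exact h.continuous.comp continuous_snd
  | succ n ih =>
    refine ⟨h.continuous.comp continuous_snd, fun _ => deriv φ, fun _ x =>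
      (h.differentiable (by simp) x).hasDerivAt, ih ?_⟩
    exact ((contDiff_succ_iff_deriv (n := n)).1 (by exact_mod_cast h)).2.2

theorem const (c : ℝ) : ContDiffInSpace n fun _ _ => c := of_contDiff contDiff_const

theorem integral (hf : ContDiffInSpace n f) {σ : ℝ → ℝ} (hσ : Continuous σ) :
    ContDiffInSpace n fun t x => ∫ s in (0 : ℝ)..σ t, f s x := by
  have key {h : ℝ → ℝ → ℝ} (hh : Continuous fun p : ℝ × ℝ => h p.1 p.2) :
      Continuous fun p : ℝ × ℝ => ∫ s in (0 : ℝ)..σ p.1, h s p.2 :=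
    continuous_integral_of_continuous (f := fun p : ℝ × ℝ => fun s => h s p.2)
      (hh.comp (f := fun q : (ℝ × ℝ) × ℝ => (q.2, q.1.2)) (by fun_prop)) 0
      (hσ.comp continuous_fst)
  induction n generalizing f with
  | zero => exact key hf
  | succ n ih =>
    obtain ⟨hc, f', hd, hf'⟩ := hf
    refine ⟨key hc, _, fun t x => ?_, ih hf'⟩
    have hint (y : ℝ) : IntervalIntegrable (fun s => f s y) MeasureTheory.volume 0 (σ t) :=
      Continuous.intervalIntegrable (hc.comp (f := fun s : ℝ => (s, y)) (by fun_prop)) _ _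
    -- The difference quotient of the integral is the integral of segment means, which is continuous
    -- in `b`; no domination argument is needed.
    have hQ : Continuous fun b => ∫ s in (0 : ℝ)..σ t, segmentMean f' s x b :=
      continuous_integral_of_continuous
        ((continuous_segmentMean hf'.continuous).comp
          (f := fun q : ℝ × ℝ => (q.2, x, q.1)) (by fun_prop)) 0 continuous_const
    have := hasDerivAt_of_sub_eq_mul (F := fun x => ∫ s in (0 : ℝ)..σ t, f s x) (a := x)
      (fun b => ?_) hQ.continuousAt
    · simpa only [segmentMean_self] using this
    · rw [← intervalIntegral.integral_sub (hint b) (hint x),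
        ← intervalIntegral.integral_const_mul]
      simp only [sub_eq_mul_segmentMean hd hf'.continuous]

end ContDiffInSpace

/-! ### The velocity in the logarithmic variable -/

/-- The Biot-Savart law in the variable `z = log x`, divided by `x`, for vorticities supported
in `(c, 0)`. -/
noncomputable def logVelocity (b₁ b₂ c : ℝ) (h : ℝ → ℝ) (z : ℝ) : ℝ :=
  2 * (∫ s in c..z + b₁, h s) - (∫ s in c..z - b₂, h s) - ∫ s in c..0, h s

/-- Outside `(c, d)` the integrand contributes nothing. This bounds integrals independently of the
upper limit and removes the truncation at `x = 1` in the Biot-Savart law. -/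
theorem integral_eq_integral_clamp {h : ℝ → ℝ} (hc : Continuous h) {c d : ℝ} (hcd : c ≤ d)
    (h₀ : ∀ x, x ∉ Ioo c d → h x = 0) (y : ℝ) :
    ∫ s in c..y, h s = ∫ s in c..max c (min y d), h s := by
  have hzero {a b : ℝ} (hab : ∀ x ∈ uIcc a b, x ∉ Ioo c d) : ∫ s in a..b, h s = 0 := by
    rw [intervalIntegral.integral_congr (g := fun _ => 0) fun x hx => h₀ x (hab x hx)]
    simp
  rcases le_total y c with hy | hy
  · rw [max_eq_left (min_le_of_left_le hy), intervalIntegral.integral_same]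
    refine hzero fun x hx => ?_
    rw [uIcc_of_ge hy] at hx
    exact fun hx' => hx'.1.not_ge hx.2
  · rw [max_eq_right (le_min hy hcd)]
    rcases le_total y d with hyd | hyd
    · rw [min_eq_left hyd]
    · rw [min_eq_right hyd, ← intervalIntegral.integral_add_adjacent_intervals
        (hc.intervalIntegrable c d) (hc.intervalIntegrable d y), hzero (a := d) (b := y), add_zero]
      intro x hx
      rw [uIcc_of_le hyd] at hx
      exact fun hx' => hx'.2.not_ge hx.1

theorem abs_integral_le_of_support {h : ℝ → ℝ} (hc : Continuous h) {c K : ℝ} (hc₀ : c ≤ 0)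
    (h₀ : ∀ x, x ∉ Ioo c 0 → h x = 0) (hK : ∀ x, |h x| ≤ K) (y : ℝ) :
    |∫ s in c..y, h s| ≤ K * -c := by
  rw [integral_eq_integral_clamp hc hc₀ h₀]
  have hK₀ : 0 ≤ K := (abs_nonneg _).trans (hK 0)
  refine (intervalIntegral.norm_integral_le_of_norm_le_const (C := K) (f := h)
    fun x _ => hK x).trans ?_
  refine mul_le_mul_of_nonneg_left ?_ hK₀
  rw [abs_of_nonneg (sub_nonneg.2 (le_max_left _ _))]
  have : max c (min y 0) ≤ 0 := max_le hc₀ (min_le_right _ _)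
  linarith

section LogVelocity

variable {b₁ b₂ c : ℝ}

theorem continuous_logVelocity {g : ℝ → ℝ → ℝ} (hg : Continuous fun p : ℝ × ℝ => g p.1 p.2) :
    Continuous fun p : ℝ × ℝ => logVelocity b₁ b₂ c (g p.1) p.2 := by
  have key {σ : ℝ × ℝ → ℝ} (hσ : Continuous σ) :
      Continuous fun p : ℝ × ℝ => ∫ s in c..σ p, g p.1 s :=
    continuous_integral_of_continuous (f := fun p : ℝ × ℝ => fun s => g p.1 s)
      (hg.comp (f := fun q : (ℝ × ℝ) × ℝ => (q.1.1, q.2)) (by fun_prop)) c hσ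
  unfold logVelocity
  exact ((continuous_const.mul (key (by fun_prop))).sub (key (by fun_prop))).sub
    (key continuous_const)

theorem hasDerivAt_logVelocity {h : ℝ → ℝ} (hc : Continuous h) (z : ℝ) :
    HasDerivAt (logVelocity b₁ b₂ c h) (2 * h (z + b₁) - h (z - b₂)) z := by
  have key (y : ℝ) : HasDerivAt (fun y => ∫ s in c..y, h s) (h y) y :=
    intervalIntegral.integral_hasDerivAt_right (hc.intervalIntegrable _ _)
      (hc.stronglyMeasurableAtFilter _ _) hc.continuousAt
  have h₁ := ((key (z + b₁)).comp_add_const z b₁).const_mul 2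
  have h₂ := (key (z - b₂)).comp_sub_const z b₂
  exact (h₁.sub h₂).sub_const _

theorem abs_logVelocity_le {h : ℝ → ℝ} (hc : Continuous h) {K : ℝ} (hc₀ : c ≤ 0)
    (h₀ : ∀ x, x ∉ Ioo c 0 → h x = 0) (hK : ∀ x, |h x| ≤ K) (z : ℝ) :
    |logVelocity b₁ b₂ c h z| ≤ 4 * (K * -c) := by
  have key := fun y => abs_le.1 (abs_integral_le_of_support hc hc₀ h₀ hK y)
  have h₁ := key (z + b₁)
  have h₂ := key (z - b₂)
  have h₃ := key 0
  unfold logVelocity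
  exact abs_le.2 ⟨by linarith [h₁.1, h₂.2, h₃.2], by linarith [h₁.2, h₂.1, h₃.1]⟩

theorem logVelocity_sub {h₁ h₂ : ℝ → ℝ} (hc₁ : Continuous h₁) (hc₂ : Continuous h₂) (z : ℝ) :
    logVelocity b₁ b₂ c h₁ z - logVelocity b₁ b₂ c h₂ z
      = logVelocity b₁ b₂ c (fun x => h₁ x - h₂ x) z := by
  unfold logVelocity
  simp only [intervalIntegral.integral_sub (hc₁.intervalIntegrable _ _)
    (hc₂.intervalIntegrable _ _)]
  ring

theorem abs_logVelocity_sub_le {h : ℝ → ℝ} (hc : Continuous h) {K : ℝ} (hK : ∀ x, |h x| ≤ K)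
    (z w : ℝ) : |logVelocity b₁ b₂ c h z - logVelocity b₁ b₂ c h w| ≤ 3 * K * |z - w| := by
  refine Convex.norm_image_sub_le_of_norm_hasDerivWithin_le (s := univ)
    (fun x _ => (hasDerivAt_logVelocity hc x).hasDerivWithinAt) (fun x _ => ?_) convex_univ
    (mem_univ _) (mem_univ _)
  have h₁ := abs_le.1 (hK (x + b₁))
  have h₂ := abs_le.1 (hK (x - b₂))
  exact abs_le.2 ⟨by linarith [h₁.1, h₂.2], by linarith [h₁.2, h₂.1]⟩

end LogVelocity

/-! ### Displacements, label maps and forced transport -/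

/-- `D t a` is the displacement at time `t` of a flow starting at `a`: it is bounded by `δ` and
contracts distances by the factor `1 / 2`. -/
structure IsDisplacement (δ : ℝ) (D : ℝ → ℝ → ℝ) : Prop where
  continuous : Continuous fun p : ℝ × ℝ => D p.1 p.2
  abs_le : ∀ t a, |D t a| ≤ δ
  abs_sub_le : ∀ t a b, |D t a - D t b| ≤ 1 / 2 * |a - b|

/-- The starting point of the particle that is at `y` at time `t`. -/
noncomputable def labelMap (D : ℝ → ℝ → ℝ) (t y : ℝ) : ℝ :=
  Function.invFun (fun a => a + D t a) y

/-- The quantity with initial value `g₀` that is transported by the flow with displacement `D` while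
being forced by `r₀` times `ψ` of the position, as a function of time and label. -/
noncomputable def forcedLabel (ψ g₀ r₀ : ℝ → ℝ) (T : ℝ) (D : ℝ → ℝ → ℝ) (t a : ℝ) : ℝ :=
  g₀ a + r₀ a * ∫ s in (0 : ℝ)..clampTime T t, ψ (a + D s a)

/-- The same quantity as a function of time and position. -/
noncomputable def forcedTransport (ψ g₀ r₀ : ℝ → ℝ) (T : ℝ) (D : ℝ → ℝ → ℝ) (t y : ℝ) : ℝ :=
  forcedLabel ψ g₀ r₀ T D t (labelMap D t y)

/-- Functions bounded by `M` with Lipschitz constant `M`. -/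
structure BoundedLipschitz (M : ℝ) (f : ℝ → ℝ) : Prop where
  abs_le : ∀ x, |f x| ≤ M
  abs_sub_le : ∀ x y, |f x - f y| ≤ M * |x - y|

theorem BoundedLipschitz.nonneg {M : ℝ} {f : ℝ → ℝ} (hf : BoundedLipschitz M f) : 0 ≤ M :=
  (abs_nonneg _).trans (hf.abs_le 0)

theorem BoundedLipschitz.mono {M N : ℝ} {f : ℝ → ℝ} (hf : BoundedLipschitz M f) (h : M ≤ N) :
    BoundedLipschitz N f :=
  ⟨fun x => (hf.abs_le x).trans h, fun x y =>
    (hf.abs_sub_le x y).trans (mul_le_mul_of_nonneg_right h (abs_nonneg _))⟩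

theorem BoundedLipschitz.continuous {M : ℝ} {f : ℝ → ℝ} (hf : BoundedLipschitz M f) :
    Continuous f :=
  (LipschitzWith.of_dist_le_mul (K := ⟨M, hf.nonneg⟩) hf.abs_sub_le).continuous

namespace IsDisplacement

variable {δ : ℝ} {D D₁ D₂ : ℝ → ℝ → ℝ}

/-- A perturbation of the identity by a 1/2-contraction expands distances by at least 1/2.
Injectivity, continuity and stability of the label map all come from this. -/
theorem abs_sub_le_two_mul (hD : IsDisplacement δ D) (t a b : ℝ) :
    |a - b| ≤ 2 * |(a + D t a) - (b + D t b)| := by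
  have h₁ := hD.abs_sub_le t a b
  have h₂ : |a - b| ≤ |(a + D t a) - (b + D t b)| + |D t a - D t b| := by
    rw [show a - b = ((a + D t a) - (b + D t b)) - (D t a - D t b) by ring]
    exact abs_sub _ _
  linarith

theorem labelMap_apply (hD : IsDisplacement δ D) (t a : ℝ) : labelMap D t (a + D t a) = a := by
  refine Function.leftInverse_invFun (f := fun a => a + D t a) (fun a b hab => ?_) a
  have := hD.abs_sub_le_two_mul t a b
  rw [sub_eq_zero.2 hab, abs_zero, mul_zero] at this
  exact sub_eq_zero.1 (abs_eq_zero.1 (le_antisymm this (abs_nonneg _)))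

theorem apply_labelMap (hD : IsDisplacement δ D) (t y : ℝ) :
    labelMap D t y + D t (labelMap D t y) = y := by
  refine Function.rightInverse_invFun (f := fun a => a + D t a) ?_ y
  have hb := fun a => _root_.abs_le.1 (hD.abs_le t a)
  -- Since the displacement is bounded, the position tends to `±∞` with the label.
  refine Continuous.surjective ?_ ?_ ?_
  · exact continuous_id.add (hD.continuous.comp (f := fun a : ℝ => (t, a)) (by fun_prop))
  · exact tendsto_atTop_mono (fun a => add_le_add_right (hb a).1 a)
      (tendsto_atTop_add_const_right _ _ tendsto_id)
  · exact tendsto_atBot_mono (fun a => add_le_add_right (hb a).2 a)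
      (tendsto_atBot_add_const_right _ _ tendsto_id)

theorem continuous_labelMap (hD : IsDisplacement δ D) :
    Continuous fun p : ℝ × ℝ => labelMap D p.1 p.2 := by
  refine continuous_iff_continuousAt.2 fun q => ?_
  obtain ⟨s, y'⟩ := q
  set b := labelMap D s y' with hb
  rw [ContinuousAt, tendsto_iff_dist_tendsto_zero]
  have hlim : Tendsto (fun p : ℝ × ℝ => 2 * |p.2 - (b + D p.1 b)|) (𝓝 (s, y')) (𝓝 0) := by
    have hc : Continuous fun p : ℝ × ℝ => 2 * |p.2 - (b + D p.1 b)| := by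
      have := hD.continuous.comp (f := fun p : ℝ × ℝ => (p.1, b)) (by fun_prop)
      exact continuous_const.mul (continuous_snd.sub (continuous_const.add this)).abs
    have := hc.tendsto (s, y')
    simpa [hb, hD.apply_labelMap] using this
  refine squeeze_zero (fun _ => dist_nonneg) (fun p => ?_) hlim
  have := hD.abs_sub_le_two_mul p.1 (labelMap D p.1 p.2) b
  rwa [hD.apply_labelMap] at this

theorem abs_labelMap_sub_le (h₁ : IsDisplacement δ D₁) (h₂ : IsDisplacement δ D₂) {ε : ℝ}
    (hε : ∀ t a, |D₁ t a - D₂ t a| ≤ ε) (t y : ℝ) :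
    |labelMap D₁ t y - labelMap D₂ t y| ≤ 2 * ε := by
  refine (h₁.abs_sub_le_two_mul t _ _).trans (mul_le_mul_of_nonneg_left ?_ zero_le_two)
  rw [h₁.apply_labelMap, abs_sub_comm]
  rw [show labelMap D₂ t y + D₁ t (labelMap D₂ t y) - y
    = D₁ t (labelMap D₂ t y) - D₂ t (labelMap D₂ t y) by linarith [h₂.apply_labelMap t y]]
  exact hε t _

variable {ψ g₀ r₀ : ℝ → ℝ} {M T : ℝ}

theorem continuous_forcedLabel (hD : IsDisplacement δ D) (hψ : Continuous ψ)
    (hg : Continuous g₀) (hr : Continuous r₀) :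
    Continuous fun p : ℝ × ℝ => forcedLabel ψ g₀ r₀ T D p.1 p.2 := by
  unfold forcedLabel
  refine (hg.comp continuous_snd).add ((hr.comp continuous_snd).mul ?_)
  refine continuous_integral_of_continuous (f := fun p : ℝ × ℝ => fun s => ψ (p.2 + D s p.2)) ?_ 0
    ((continuous_clampTime T).comp continuous_fst)
  have := hD.continuous.comp (f := fun q : (ℝ × ℝ) × ℝ => (q.2, q.1.2)) (by fun_prop)
  exact hψ.comp ((continuous_snd.comp continuous_fst).add this)

theorem continuous_forcedTransport (hD : IsDisplacement δ D) (hψ : Continuous ψ)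
    (hg : Continuous g₀) (hr : Continuous r₀) :
    Continuous fun p : ℝ × ℝ => forcedTransport ψ g₀ r₀ T D p.1 p.2 :=
  (hD.continuous_forcedLabel hψ hg hr).comp (f := fun p : ℝ × ℝ => (p.1, labelMap D p.1 p.2))
    (continuous_fst.prodMk hD.continuous_labelMap)

theorem continuous_along (hD : IsDisplacement δ D) (hψ : Continuous ψ) (a : ℝ) :
    Continuous fun s => ψ (a + D s a) :=
  hψ.comp (continuous_const.add (hD.continuous.comp (f := fun s : ℝ => (s, a)) (by fun_prop)))

theorem abs_integral_clamp_le {f : ℝ → ℝ} {K : ℝ} (hT : 0 ≤ T) (hf : ∀ s, |f s| ≤ K) (t : ℝ) :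
    |∫ s in (0 : ℝ)..clampTime T t, f s| ≤ K * T := by
  have hK : 0 ≤ K := (abs_nonneg _).trans (hf 0)
  refine (intervalIntegral.norm_integral_le_of_norm_le_const (C := K) (f := f)
    fun x _ => hf x).trans ?_
  refine mul_le_mul_of_nonneg_left ?_ hK
  rw [sub_zero, abs_of_nonneg (clampTime_nonneg _ _)]
  exact clampTime_le hT t

theorem abs_forcedLabel_le (hT : 0 ≤ T) (hT₁ : T ≤ 1)
    (hψ : BoundedLipschitz M ψ) (hg : BoundedLipschitz M g₀) (hr : BoundedLipschitz M r₀)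
    (t a : ℝ) : |forcedLabel ψ g₀ r₀ T D t a| ≤ M + 3 * M ^ 2 := by
  have hM := hψ.nonneg
  have h₁ := abs_integral_clamp_le hT (fun s => hψ.abs_le (a + D s a)) t
  have h₂ : M * T ≤ M := mul_le_of_le_one_right hM hT₁
  unfold forcedLabel
  refine (abs_add_le _ _).trans (add_le_add (hg.abs_le a) ?_)
  rw [abs_mul]
  have := mul_le_mul (hr.abs_le a) (h₁.trans h₂) (abs_nonneg _) hM
  nlinarith

/-- Positions are 3/2-Lipschitz in the label, so the three terms of the product rule contribute `M`,
`M ^ 2` and `3 / 2 * M ^ 2`. The constant is rounded up to `M + 3 * M ^ 2`, which also serves as the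
sup bound. -/
theorem abs_forcedLabel_sub_le (hD : IsDisplacement δ D) (hT : 0 ≤ T) (hT₁ : T ≤ 1)
    (hψ : BoundedLipschitz M ψ) (hg : BoundedLipschitz M g₀) (hr : BoundedLipschitz M r₀)
    (t a b : ℝ) : |forcedLabel ψ g₀ r₀ T D t a - forcedLabel ψ g₀ r₀ T D t b|
      ≤ (M + 3 * M ^ 2) * |a - b| := by
  have hM := hψ.nonneg
  have hab := abs_nonneg (a - b)
  set I := fun a => ∫ s in (0 : ℝ)..clampTime T t, ψ (a + D s a) with hI
  have h₁ : |I b| ≤ M := (abs_integral_clamp_le hT (fun s => hψ.abs_le (b + D s b)) t).trans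
    (mul_le_of_le_one_right hM hT₁)
  have h₁a : |I a| ≤ M := (abs_integral_clamp_le hT (fun s => hψ.abs_le (a + D s a)) t).trans
    (mul_le_of_le_one_right hM hT₁)
  have h₂ : |I a - I b| ≤ M * (3 / 2 * |a - b|) := by
    rw [hI]
    simp only
    rw [← intervalIntegral.integral_sub
      ((hD.continuous_along hψ.continuous a).intervalIntegrable _ _)
      ((hD.continuous_along hψ.continuous b).intervalIntegrable _ _)]
    refine (abs_integral_clamp_le (K := M * (3 / 2 * |a - b|)) hT (fun s => ?_) t).trans
      (mul_le_of_le_one_right (by positivity) hT₁)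
    refine (hψ.abs_sub_le _ _).trans (mul_le_mul_of_nonneg_left ?_ hM)
    rw [show a + D s a - (b + D s b) = (a - b) + (D s a - D s b) by ring]
    have := abs_add_le (a - b) (D s a - D s b)
    linarith [hD.abs_sub_le s a b]
  have h₃ : forcedLabel ψ g₀ r₀ T D t a - forcedLabel ψ g₀ r₀ T D t b
      = (g₀ a - g₀ b) + ((r₀ a - r₀ b) * I a + r₀ b * (I a - I b)) := by
    simp only [forcedLabel, hI]; ring
  rw [h₃]
  have h₄ : |(r₀ a - r₀ b) * I a| ≤ M * |a - b| * M := by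
    rw [abs_mul]
    exact mul_le_mul (hr.abs_sub_le a b) h₁a (abs_nonneg _) (by positivity)
  have h₅ : |r₀ b * (I a - I b)| ≤ M * (M * (3 / 2 * |a - b|)) := by
    rw [abs_mul]
    exact mul_le_mul (hr.abs_le b) h₂ (abs_nonneg _) hM
  have h₆ := abs_add_le (g₀ a - g₀ b) ((r₀ a - r₀ b) * I a + r₀ b * (I a - I b))
  have h₇ := abs_add_le ((r₀ a - r₀ b) * I a) (r₀ b * (I a - I b))
  have h₈ : 0 ≤ M ^ 2 * |a - b| := by positivity
  nlinarith [hg.abs_sub_le a b]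

theorem abs_forcedLabel_sub_forcedLabel_le (h₁ : IsDisplacement δ D₁) (h₂ : IsDisplacement δ D₂)
    (hT : 0 ≤ T) (hT₁ : T ≤ 1)
    (hψ : BoundedLipschitz M ψ) (hr : BoundedLipschitz M r₀) {ε : ℝ}
    (hε : ∀ t a, |D₁ t a - D₂ t a| ≤ ε) (t a : ℝ) :
    |forcedLabel ψ g₀ r₀ T D₁ t a - forcedLabel ψ g₀ r₀ T D₂ t a| ≤ M ^ 2 * ε := by
  have hM := hψ.nonneg
  have hε₀ : 0 ≤ ε := (abs_nonneg _).trans (hε 0 0)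
  unfold forcedLabel
  rw [add_sub_add_left_eq_sub, ← mul_sub, abs_mul, ← intervalIntegral.integral_sub
      ((h₁.continuous_along hψ.continuous a).intervalIntegrable _ _)
      ((h₂.continuous_along hψ.continuous a).intervalIntegrable _ _)]
  have := (abs_integral_clamp_le (K := M * ε)
    (f := fun s => ψ (a + D₁ s a) - ψ (a + D₂ s a)) hT (fun s => ?_) t).trans
      (mul_le_of_le_one_right (by positivity) hT₁)
  · have := mul_le_mul (hr.abs_le a) this (abs_nonneg _) hM
    linarith
  · refine (hψ.abs_sub_le _ _).trans (mul_le_mul_of_nonneg_left ?_ hM)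
    rw [add_sub_add_left_eq_sub]
    exact hε s a

/-- Changing the displacement moves the label by at most `2 * ε`, which costs the Lipschitz constant
in the label, and changes the accumulated forcing at a fixed label by at most `M ^ 2 * ε`. -/
theorem abs_forcedTransport_sub_le (h₁ : IsDisplacement δ D₁) (h₂ : IsDisplacement δ D₂)
    (hT : 0 ≤ T) (hT₁ : T ≤ 1)
    (hψ : BoundedLipschitz M ψ) (hg : BoundedLipschitz M g₀) (hr : BoundedLipschitz M r₀) {ε : ℝ}
    (hε : ∀ t a, |D₁ t a - D₂ t a| ≤ ε) (t y : ℝ) :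
    |forcedTransport ψ g₀ r₀ T D₁ t y - forcedTransport ψ g₀ r₀ T D₂ t y|
      ≤ 3 * (M + 3 * M ^ 2) * ε := by
  have hM := hψ.nonneg
  have hε₀ : 0 ≤ ε := (abs_nonneg _).trans (hε 0 0)
  have e₁ := h₁.abs_forcedLabel_sub_le hT hT₁ hψ hg hr t (labelMap D₁ t y) (labelMap D₂ t y)
  have e₂ := h₁.abs_forcedLabel_sub_forcedLabel_le (g₀ := g₀) h₂ hT hT₁ hψ hr hε t
    (labelMap D₂ t y)
  have e₃ := mul_le_mul_of_nonneg_left (h₁.abs_labelMap_sub_le h₂ hε t y)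
    (show 0 ≤ M + 3 * M ^ 2 by positivity)
  have e₄ := _root_.abs_sub_le (forcedLabel ψ g₀ r₀ T D₁ t (labelMap D₁ t y))
    (forcedLabel ψ g₀ r₀ T D₁ t (labelMap D₂ t y)) (forcedLabel ψ g₀ r₀ T D₂ t (labelMap D₂ t y))
  unfold forcedTransport
  nlinarith [mul_nonneg hM hε₀, mul_nonneg (sq_nonneg M) hε₀]

theorem forcedTransport_eq_zero (hD : IsDisplacement δ D) {c d : ℝ}
    (hg : ∀ x, x ∉ Icc (c + δ) (d - δ) → g₀ x = 0) (hr : ∀ x, x ∉ Icc (c + δ) (d - δ) → r₀ x = 0)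
    (t y : ℝ) (hy : y ∉ Icc c d) : forcedTransport ψ g₀ r₀ T D t y = 0 := by
  have : labelMap D t y ∉ Icc (c + δ) (d - δ) := fun h => hy <| by
    have h₁ := _root_.abs_le.1 (hD.abs_le t (labelMap D t y))
    have h₂ := hD.apply_labelMap t y
    exact ⟨by linarith [h.1], by linarith [h.2]⟩
  simp [forcedTransport, forcedLabel, hg _ this, hr _ this]

end IsDisplacement

/-! ### Construction of the flow by contraction -/

open BoundedContinuousFunction in
/-- Displacements whose velocity depends on them in a Lipschitz way exist for short times. -/
theorem exists_isDisplacement_eq_integral {δ C T : ℝ} {V : (ℝ → ℝ → ℝ) → ℝ → ℝ → ℝ} (hδ : 0 ≤ δ)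
    (hC : 0 ≤ C) (hT : 0 ≤ T) (hTδ : T * C ≤ δ) (hTC : T * C ≤ 1 / 4)
    (hV : ∀ D, IsDisplacement δ D → Continuous fun p : ℝ × ℝ => V D p.1 p.2)
    (hVC : ∀ D, IsDisplacement δ D → ∀ t z, |V D t z| ≤ C)
    (hVL : ∀ D, IsDisplacement δ D → ∀ t z w, |V D t z - V D t w| ≤ C * |z - w|)
    (hVV : ∀ D₁ D₂, IsDisplacement δ D₁ → IsDisplacement δ D₂ → ∀ ε,
      (∀ t a, |D₁ t a - D₂ t a| ≤ ε) → ∀ t z, |V D₁ t z - V D₂ t z| ≤ C * ε) :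
    ∃ D, IsDisplacement δ D ∧
      ∀ t a, D t a = ∫ s in (0 : ℝ)..clampTime T t, V D s (a + D s a) := by
  let Φ : (ℝ → ℝ → ℝ) → ℝ → ℝ → ℝ := fun D t a =>
    ∫ s in (0 : ℝ)..clampTime T t, V D s (a + D s a)
  have halong (D) (hD : IsDisplacement δ D) (a : ℝ) : Continuous fun s => V D s (a + D s a) :=
    (hV D hD).comp (f := fun s : ℝ => (s, a + D s a)) (continuous_id.prodMk
      (continuous_const.add (hD.continuous.comp (f := fun s : ℝ => (s, a)) (by fun_prop))))
  have hΦ (D) (hD : IsDisplacement δ D) : IsDisplacement δ (Φ D) := by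
    refine ⟨?_, fun t a => ?_, fun t a b => ?_⟩
    · refine continuous_integral_of_continuous
        (f := fun p : ℝ × ℝ => fun s => V D s (p.2 + D s p.2)) ?_ 0
        ((continuous_clampTime T).comp continuous_fst)
      have := hD.continuous.comp (f := fun q : (ℝ × ℝ) × ℝ => (q.2, q.1.2)) (by fun_prop)
      exact (hV D hD).comp (f := fun q : (ℝ × ℝ) × ℝ => (q.2, q.1.2 + D q.2 q.1.2))
        (continuous_snd.prodMk ((continuous_snd.comp continuous_fst).add this))
    · refine (IsDisplacement.abs_integral_clamp_le hT (fun s => hVC D hD _ _) t).trans ?_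
      rwa [mul_comm]
    · have hab := abs_nonneg (a - b)
      simp only [Φ]
      rw [← intervalIntegral.integral_sub ((halong D hD a).intervalIntegrable _ _)
        ((halong D hD b).intervalIntegrable _ _)]
      -- Positions are 3/2-Lipschitz in the label, and `T * C ≤ 1 / 4` turns the factor into `3 / 8
      -- ≤ 1 / 2`.
      refine (IsDisplacement.abs_integral_clamp_le (K := C * (3 / 2 * |a - b|)) hT
        (fun s => ?_) t).trans (by nlinarith)
      refine (hVL D hD s _ _).trans (mul_le_mul_of_nonneg_left ?_ hC)
      rw [show a + D s a - (b + D s b) = (a - b) + (D s a - D s b) by ring]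
      have := abs_add_le (a - b) (D s a - D s b)
      linarith [hD.abs_sub_le s a b]
  have hΦΦ (D₁ D₂) (h₁ : IsDisplacement δ D₁) (h₂ : IsDisplacement δ D₂) (ε : ℝ)
      (hε : ∀ t a, |D₁ t a - D₂ t a| ≤ ε) (t a : ℝ) : |Φ D₁ t a - Φ D₂ t a| ≤ 1 / 2 * ε := by
    have hε₀ : 0 ≤ ε := (abs_nonneg _).trans (hε 0 0)
    simp only [Φ]
    rw [← intervalIntegral.integral_sub ((halong D₁ h₁ a).intervalIntegrable _ _)
      ((halong D₂ h₂ a).intervalIntegrable _ _)]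
    -- One `C * ε` comes from evaluating the velocity at another position, the other from the change
    -- of the velocity field itself.
    refine (IsDisplacement.abs_integral_clamp_le (K := 2 * C * ε) hT
      (fun s => ?_) t).trans (by nlinarith)
    have e₁ := hVL D₁ h₁ s (a + D₁ s a) (a + D₂ s a)
    rw [add_sub_add_left_eq_sub] at e₁
    have e₂ := hVV D₁ D₂ h₁ h₂ ε hε s (a + D₂ s a)
    have e₃ := mul_le_mul_of_nonneg_left (hε s a) hC
    linarith [abs_sub_le (V D₁ s (a + D₁ s a)) (V D₁ s (a + D₂ s a)) (V D₂ s (a + D₂ s a))]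
  let S : Set (ℝ × ℝ →ᵇ ℝ) := {F | IsDisplacement δ fun t a => F (t, a)}
  -- Continuity is built into the ambient space, so only pointwise inequalities remain, and these
  -- are closed conditions.
  have hS : IsClosed S := by
    have : S = (⋂ p : ℝ × ℝ, {F : ℝ × ℝ →ᵇ ℝ | |F p| ≤ δ}) ∩
        ⋂ q : ℝ × ℝ × ℝ, {F : ℝ × ℝ →ᵇ ℝ | |F (q.1, q.2.1) - F (q.1, q.2.2)|
          ≤ 1 / 2 * |q.2.1 - q.2.2|} := by
      ext F
      simp only [S, mem_ofPred_eq, mem_inter_iff, mem_iInter, Prod.forall]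
      exact ⟨fun h => ⟨h.abs_le, h.abs_sub_le⟩, fun h => ⟨F.continuous, h.1, h.2⟩⟩
    rw [this]
    have hev (p : ℝ × ℝ) : Continuous fun F : ℝ × ℝ →ᵇ ℝ => F p :=
      continuous_eval_const (F := ℝ × ℝ →ᵇ ℝ) p
    refine (isClosed_iInter fun p => isClosed_le (hev p).abs continuous_const).inter
      (isClosed_iInter fun q => isClosed_le ((hev _).sub (hev _)).abs continuous_const)
  have : CompleteSpace S := hS.completeSpace_coe
  have h₀ : IsDisplacement δ fun _ _ => 0 :=
    ⟨continuous_const, fun _ _ => by simpa using hδ, fun _ a b => by simp⟩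
  have : Nonempty S := ⟨⟨0, h₀⟩⟩
  let Ψ : S → S := fun F => ⟨ofNormedAddCommGroup
    (fun p : ℝ × ℝ => Φ (fun t a => F.1 (t, a)) p.1 p.2) (hΦ _ F.2).continuous δ
    fun p => (hΦ _ F.2).abs_le p.1 p.2, hΦ _ F.2⟩
  have hΨ : ContractingWith (1 / 2) Ψ := by
    refine ⟨by norm_num, LipschitzWith.of_dist_le_mul fun F G => ?_⟩
    rw [Subtype.dist_eq, BoundedContinuousFunction.dist_le (by positivity)]
    intro p
    have := hΦΦ _ _ F.2 G.2 (dist F G) (fun t a => dist_coe_le_dist (f := F.1) (g := G.1) (t, a))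
      p.1 p.2
    simpa [Ψ, Real.dist_eq] using this
  let F := hΨ.fixedPoint
  refine ⟨fun t a => F.1 (t, a), F.2, fun t a => ?_⟩
  have := congrArg (fun G : S => G.1 (t, a)) (hΨ.fixedPoint_isFixedPt)
  exact this.symm

/-- Short time existence of the flow generated by the forced transport of Lipschitz data. -/
theorem exists_flow_displacement {b₁ b₂ c δ M : ℝ} {ψ g₀ r₀ : ℝ → ℝ} (hδ : 0 < δ) (hc : c < -δ)
    (hψ : BoundedLipschitz M ψ) (hg : BoundedLipschitz M g₀) (hr : BoundedLipschitz M r₀)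
    (hg₀ : ∀ x, x ∉ Icc (c + 2 * δ) (-2 * δ) → g₀ x = 0)
    (hr₀ : ∀ x, x ∉ Icc (c + 2 * δ) (-2 * δ) → r₀ x = 0) :
    ∃ T, 0 < T ∧ ∃ D, IsDisplacement δ D ∧ ∀ t a, D t a = ∫ s in (0 : ℝ)..clampTime T t,
      logVelocity b₁ b₂ c (forcedTransport ψ g₀ r₀ T D s) (a + D s a) := by
  have hM := hψ.nonneg
  have hK : 0 ≤ M + 3 * M ^ 2 := by positivity
  obtain ⟨K, hKdef⟩ : ∃ K, K = M + 3 * M ^ 2 := ⟨_, rfl⟩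
  rw [← hKdef] at hK
  have hcn : 0 < -c := by linarith
  -- `3 * K` is the Lipschitz constant of the velocity and `4 * (K * -c)` its bound. Its dependence
  -- on the displacement costs `4 * (3 * K) * -c`, and `1` makes `C` positive.
  obtain ⟨C, hCdef⟩ : ∃ C, C = 3 * K + 12 * (K * -c) + 1 := ⟨_, rfl⟩
  have hC : 0 < C := by rw [hCdef]; positivity
  have hKc : 0 ≤ K * -c := by positivity
  obtain ⟨T, hT, hT₁, hTδ, hTC⟩ : ∃ T : ℝ, 0 < T ∧ T ≤ 1 ∧ T * C ≤ δ ∧ T * C ≤ 1 / 4 := by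
    refine ⟨min 1 (min (δ / C) (1 / 4 / C)), by positivity, min_le_left _ _, ?_, ?_⟩
    · rw [← le_div_iff₀ hC]
      exact (min_le_right _ _).trans (min_le_left _ _)
    · rw [← le_div_iff₀ hC]
      exact (min_le_right _ _).trans (min_le_right _ _)
  refine ⟨T, hT, ?_⟩
  have hgc (D) (hD : IsDisplacement δ D) :=
    hD.continuous_forcedTransport (T := T) hψ.continuous hg.continuous hr.continuous
  have hgt (D) (hD : IsDisplacement δ D) (t : ℝ) :
      Continuous (forcedTransport ψ g₀ r₀ T D t) :=
    (hgc D hD).comp (f := fun y : ℝ => (t, y)) (by fun_prop)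
  have hsupp (D) (hD : IsDisplacement δ D) (t y : ℝ) (hy : y ∉ Ioo c 0) :
      forcedTransport ψ g₀ r₀ T D t y = 0 := by
    -- The data keep a margin `2 * δ` from the ends of `(c, 0)` and particles move by at most `δ`,
    -- so a margin `δ` is left.
    refine hD.forcedTransport_eq_zero (c := c + δ) (d := -δ) (fun x hx => hg₀ x fun h => hx ?_)
      (fun x hx => hr₀ x fun h => hx ?_) t y fun h => hy ?_
    · exact ⟨by linarith [h.1], by linarith [h.2]⟩
    · exact ⟨by linarith [h.1], by linarith [h.2]⟩
    · exact ⟨by linarith [h.1], by linarith [h.2]⟩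
  have hbd (D) (t y : ℝ) : |forcedTransport ψ g₀ r₀ T D t y| ≤ K :=
    hKdef ▸ IsDisplacement.abs_forcedLabel_le hT.le hT₁ hψ hg hr t _
  refine exists_isDisplacement_eq_integral
    (V := fun D t => logVelocity b₁ b₂ c (forcedTransport ψ g₀ r₀ T D t)) hδ.le hC.le hT.le hTδ hTC
    (fun D hD => continuous_logVelocity (hgc D hD)) (fun D hD t z => ?_) (fun D hD t z w => ?_)
    (fun D₁ D₂ h₁ h₂ ε hε t z => ?_)
  · refine (abs_logVelocity_le (hgt D hD t) (by linarith) (hsupp D hD t) (hbd D t) z).trans ?_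
    linarith
  · refine (abs_logVelocity_sub_le (hgt D hD t) (hbd D t) z w).trans
      (mul_le_mul_of_nonneg_right ?_ (abs_nonneg _))
    linarith
  · have hε₀ : 0 ≤ ε := (abs_nonneg _).trans (hε 0 0)
    rw [logVelocity_sub (hgt D₁ h₁ t) (hgt D₂ h₂ t)]
    refine (abs_logVelocity_le ((hgt D₁ h₁ t).sub (hgt D₂ h₂ t)) (by linarith) (fun x hx => ?_)
      (h₁.abs_forcedTransport_sub_le h₂ hT.le hT₁ hψ hg hr hε t) z).trans ?_
    · simp [hsupp D₁ h₁ t x hx, hsupp D₂ h₂ t x hx]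
    · rw [← hKdef]
      nlinarith [mul_nonneg hK hε₀, mul_nonneg hKc hε₀]

/-! ### Differentiability of the flow and of the transported quantities -/

theorem clampTime_clampTime {T : ℝ} (hT : 0 ≤ T) (t : ℝ) :
    clampTime T (clampTime T t) = clampTime T t :=
  clampTime_of_mem ⟨clampTime_nonneg T t, clampTime_le hT t⟩

theorem hasDerivWithinAt_integral_clampTime {f : ℝ → ℝ} (hf : Continuous f) {T t : ℝ}
    (ht : t ∈ Icc 0 T) :
    HasDerivWithinAt (fun t => ∫ s in (0 : ℝ)..clampTime T t, f s) (f t) (Icc 0 T) t := by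
  have h : HasDerivAt (fun t => ∫ s in (0 : ℝ)..t, f s) (f t) t :=
    intervalIntegral.integral_hasDerivAt_right (hf.intervalIntegrable _ _)
      (hf.stronglyMeasurableAtFilter _ _) hf.continuousAt
  refine h.hasDerivWithinAt.congr (fun s hs => ?_) ?_
  · rw [clampTime_of_mem hs]
  · rw [clampTime_of_mem ht]

theorem ContDiffInSpace.sub {n : ℕ} {f g : ℝ → ℝ → ℝ} (hf : ContDiffInSpace n f)
    (hg : ContDiffInSpace n g) : ContDiffInSpace n fun t x => f t x - g t x := by
  simpa [sub_eq_add_neg] using hf.add ((ContDiffInSpace.const (-1)).mul hg)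

theorem eq_mul_exp_integral_of_hasDerivWithinAt {Y q : ℝ → ℝ} {T : ℝ} (hq : Continuous q)
    (hY : ∀ t ∈ Icc 0 T, HasDerivWithinAt Y (Y t * q t) (Icc 0 T) t) {t : ℝ} (ht : t ∈ Icc 0 T) :
    Y t = Y 0 * Real.exp (∫ s in (0 : ℝ)..t, q s) := by
  have hI (t : ℝ) : HasDerivAt (fun t => ∫ s in (0 : ℝ)..t, q s) (q t) t :=
    intervalIntegral.integral_hasDerivAt_right (hq.intervalIntegrable _ _)
      (hq.stronglyMeasurableAtFilter _ _) hq.continuousAt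
  have hE (t) (ht : t ∈ Icc 0 T) : HasDerivWithinAt
      (fun t => Y t * Real.exp (-∫ s in (0 : ℝ)..t, q s)) 0 (Icc 0 T) t := by
    have := (hY t ht).mul (hI t).neg.exp.hasDerivWithinAt
    refine this.congr_deriv ?_
    ring
  have := constant_of_derivWithin_zero (fun t ht => (hE t ht).differentiableWithinAt)
    (fun t ht => (hE t (Ico_subset_Icc_self ht)).derivWithin
      (uniqueDiffOn_Icc (ht.1.trans_lt ht.2) t (Ico_subset_Icc_self ht))) t ht
  simp only [intervalIntegral.integral_same, neg_zero, Real.exp_zero, mul_one] at this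
  rw [← this, mul_assoc, ← Real.exp_add, neg_add_cancel, Real.exp_zero, mul_one]

/-- The displacement `D` is generated on `[0, T]` by the velocity `v`, whose spatial derivative is
`v'`. -/
structure IsFlow (δ T : ℝ) (v v' D : ℝ → ℝ → ℝ) : Prop extends IsDisplacement δ D where
  nonneg : 0 ≤ T
  continuous_velocity : Continuous fun p : ℝ × ℝ => v p.1 p.2
  continuous_deriv : Continuous fun p : ℝ × ℝ => v' p.1 p.2
  hasDerivAt : ∀ t z, HasDerivAt (v t) (v' t z) z
  eq_integral : ∀ t a, D t a = ∫ s in (0 : ℝ)..clampTime T t, v s (a + D s a)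

namespace IsFlow

variable {δ T : ℝ} {v v' D : ℝ → ℝ → ℝ}

theorem continuous_position (h : IsFlow δ T v v' D) :
    Continuous fun p : ℝ × ℝ => p.2 + D p.1 p.2 := continuous_snd.add h.continuous

theorem continuous_path (h : IsFlow δ T v v' D) (a : ℝ) : Continuous fun t => a + D t a :=
  h.continuous_position.comp (f := fun t : ℝ => (t, a)) (by fun_prop)

theorem hasDerivWithinAt_position (h : IsFlow δ T v v' D) {t : ℝ} (ht : t ∈ Icc 0 T) (a : ℝ) :
    HasDerivWithinAt (fun t => a + D t a) (v t (a + D t a)) (Icc 0 T) t := by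
  have hc : Continuous fun s => v s (a + D s a) :=
    h.continuous_velocity.comp (f := fun s : ℝ => (s, a + D s a))
      (continuous_id.prodMk (h.continuous_path a))
  simpa only [← h.eq_integral] using (hasDerivWithinAt_integral_clampTime hc ht).const_add a

/-- The quotient of the distances of two particles at times `t` and `0`. -/
noncomputable def stretch (T : ℝ) (v' D : ℝ → ℝ → ℝ) (t a b : ℝ) : ℝ :=
  Real.exp (∫ s in (0 : ℝ)..clampTime T t, segmentMean v' s (a + D s a) (b + D s b))

theorem continuous_stretch (h : IsFlow δ T v v' D) :
    Continuous fun p : ℝ × ℝ × ℝ => stretch T v' D p.1 p.2.1 p.2.2 := by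
  refine Real.continuous_exp.comp ?_
  refine continuous_integral_of_continuous (f := fun p : ℝ × ℝ × ℝ => fun s =>
    segmentMean v' s (p.2.1 + D s p.2.1) (p.2.2 + D s p.2.2)) ?_ 0
    ((continuous_clampTime T).comp continuous_fst)
  refine (continuous_segmentMean h.continuous_deriv).comp (f := fun q : (ℝ × ℝ × ℝ) × ℝ =>
    (q.2, q.1.2.1 + D q.2 q.1.2.1, q.1.2.2 + D q.2 q.1.2.2)) ?_
  refine continuous_snd.prodMk (Continuous.prodMk ?_ ?_)
  · exact h.continuous_position.comp (f := fun q : (ℝ × ℝ × ℝ) × ℝ => (q.2, q.1.2.1)) (by fun_prop)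
  · exact h.continuous_position.comp (f := fun q : (ℝ × ℝ × ℝ) × ℝ => (q.2, q.1.2.2)) (by fun_prop)

/-- The distance of two particles solves a linear equation whose coefficient is the mean of `v'`
over the segment between them; an integrating factor solves it exactly. Letting the labels merge
gives the spatial derivative of the flow. -/
theorem sub_eq_mul_stretch (h : IsFlow δ T v v' D) (t a b : ℝ) :
    (b + D t b) - (a + D t a) = (b - a) * stretch T v' D t a b := by
  have hclamp (a : ℝ) : D t a = D (clampTime T t) a := by
    rw [h.eq_integral, h.eq_integral (clampTime T t), clampTime_clampTime h.nonneg]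
  have hzero (a : ℝ) : D 0 a = 0 := by
    rw [h.eq_integral, clampTime_of_mem ⟨le_rfl, h.nonneg⟩, intervalIntegral.integral_same]
  have := eq_mul_exp_integral_of_hasDerivWithinAt (T := T)
    (Y := fun t => (b + D t b) - (a + D t a))
    (q := fun s => segmentMean v' s (a + D s a) (b + D s b))
    ((continuous_segmentMean h.continuous_deriv).comp (f := fun s : ℝ =>
      (s, a + D s a, b + D s b)) (continuous_id.prodMk
        ((h.continuous_path a).prodMk (h.continuous_path b))))
    (fun s hs => ?_) ⟨clampTime_nonneg T t, clampTime_le h.nonneg t⟩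
  · simpa only [hzero, add_zero, ← hclamp, stretch] using this
  · rw [← sub_eq_mul_segmentMean h.hasDerivAt h.continuous_deriv]
    exact (h.hasDerivWithinAt_position hs b).sub (h.hasDerivWithinAt_position hs a)

theorem stretch_self (t a : ℝ) :
    stretch T v' D t a a = Real.exp (∫ s in (0 : ℝ)..clampTime T t, v' s (a + D s a)) := by
  simp only [stretch, segmentMean_self]

theorem hasDerivAt_position (h : IsFlow δ T v v' D) (t a : ℝ) :
    HasDerivAt (fun a => a + D t a) (stretch T v' D t a a) a :=
  hasDerivAt_of_sub_eq_mul (h.sub_eq_mul_stretch t a)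
    (h.continuous_stretch.comp (f := fun b : ℝ => (t, a, b)) (by fun_prop)).continuousAt

theorem stretch_pos (t a b : ℝ) : 0 < stretch T v' D t a b := Real.exp_pos _

theorem hasDerivAt_labelMap (h : IsFlow δ T v v' D) (t y : ℝ) :
    HasDerivAt (labelMap D t) (stretch T v' D t (labelMap D t y) (labelMap D t y))⁻¹ y := by
  refine HasDerivAt.of_local_left_inverse (f := fun a => a + D t a) ?_
    (h.hasDerivAt_position t _) (stretch_pos _ _ _).ne' (.of_forall (h.apply_labelMap t))
  exact (h.continuous_labelMap.comp (f := fun y : ℝ => (t, y)) (by fun_prop)).continuousAt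

/-- Let `a` be the label of `y` at time `t`. At time `s` the distance from particle `a` to `y` is
the label increment times a stretch factor, so the slope of the label map is minus that of the path
of `a` divided by a continuous positive factor. -/
theorem hasDerivWithinAt_labelMap (h : IsFlow δ T v v' D) {t : ℝ} (ht : t ∈ Icc 0 T) (y : ℝ) :
    HasDerivWithinAt (fun t => labelMap D t y)
      (-(v t y * (stretch T v' D t (labelMap D t y) (labelMap D t y))⁻¹)) (Icc 0 T) t := by
  set a := labelMap D t y with ha
  have hZ := h.hasDerivWithinAt_position ht a
  rw [ha, h.apply_labelMap, ← ha] at hZ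
  rw [hasDerivWithinAt_iff_tendsto_slope] at hZ ⊢
  have hQ : Tendsto (fun s => stretch T v' D s a (labelMap D s y)) (𝓝[Icc 0 T \ {t}] t)
      (𝓝 (stretch T v' D t a a)) := by
    have hA : Continuous fun s => labelMap D s y :=
      h.continuous_labelMap.comp (f := fun s : ℝ => (s, y)) (by fun_prop)
    have : Continuous fun s => stretch T v' D s a (labelMap D s y) :=
      h.continuous_stretch.comp (f := fun s : ℝ => (s, a, labelMap D s y))
        (continuous_id.prodMk (continuous_const.prodMk hA))
    exact (this.tendsto t).mono_left nhdsWithin_le_nhds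
  refine (hZ.mul (hQ.inv₀ (stretch_pos _ _ _).ne')).neg.congr fun s => ?_
  have e := h.sub_eq_mul_stretch s a (labelMap D s y)
  rw [h.apply_labelMap] at e
  have e₂ := h.apply_labelMap t y
  rw [← ha] at e₂
  have hpos := (stretch_pos (T := T) (v' := v') (D := D) s a (labelMap D s y)).ne'
  simp only [slope_def_field]
  rw [← ha, eq_div_of_mul_eq hpos e.symm, e₂]
  field_simp
  ring

variable {ψ g₀ r₀ : ℝ → ℝ}

/-- The regularity of the label map improves with that of the velocity. -/
theorem contDiffInSpace_succ (h : IsFlow δ T v v' D) {n : ℕ} (hv' : ContDiffInSpace n v')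
    (hZ : ContDiffInSpace n fun t a => a + D t a) (hA : ContDiffInSpace n (labelMap D)) :
    ContDiffInSpace (n + 1) (fun t a => a + D t a) ∧ ContDiffInSpace (n + 1) (labelMap D) := by
  have hP : ContDiffInSpace n fun t a =>
      ∫ s in (0 : ℝ)..clampTime T t, v' s (a + D s a) :=
    (hv'.comp hZ).integral (continuous_clampTime T)
  have hexp : ContDiffInSpace n fun _ x => Real.exp x :=
    .of_contDiff Real.contDiff_exp
  have hexp' : ContDiffInSpace n fun _ x => Real.exp (-x) :=
    .of_contDiff (Real.contDiff_exp.comp contDiff_neg)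
  refine ⟨⟨h.continuous_position, _, h.hasDerivAt_position, ?_⟩,
    ⟨h.continuous_labelMap, _, h.hasDerivAt_labelMap, ?_⟩⟩
  · simp only [stretch_self]
    exact hexp.comp hP
  · simp only [stretch_self, ← Real.exp_neg]
    exact hexp'.comp (hP.comp hA)

theorem contDiffInSpace_forcedLabel {n : ℕ} (hψ : ContDiff ℝ n ψ) (hg : ContDiff ℝ n g₀)
    (hr : ContDiff ℝ n r₀) (hZ : ContDiffInSpace n fun t a => a + D t a) :
    ContDiffInSpace n (forcedLabel ψ g₀ r₀ T D) :=
  (ContDiffInSpace.of_contDiff hg).add ((ContDiffInSpace.of_contDiff hr).mul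
    (((ContDiffInSpace.of_contDiff hψ).comp hZ).integral (continuous_clampTime T)))

theorem contDiffInSpace_forcedTransport {n : ℕ} (hψ : ContDiff ℝ n ψ) (hg : ContDiff ℝ n g₀)
    (hr : ContDiff ℝ n r₀) (hZ : ContDiffInSpace n fun t a => a + D t a)
    (hA : ContDiffInSpace n (labelMap D)) : ContDiffInSpace n (forcedTransport ψ g₀ r₀ T D) :=
  (contDiffInSpace_forcedLabel hψ hg hr hZ).comp hA

/-- At a fixed label only the forcing acts. The motion of the label contributes `-v` times the
spatial derivative, since the time and space derivatives of the label map differ by the factor `-v`.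
-/
theorem hasDerivWithinAt_forcedTransport (h : IsFlow δ T v v' D) (hψ : ContDiff ℝ 1 ψ)
    (hg : ContDiff ℝ 1 g₀) (hr : ContDiff ℝ 1 r₀)
    (hZ : ContDiffInSpace 1 fun t a => a + D t a) {t : ℝ} (ht : t ∈ Icc 0 T) (y : ℝ) :
    HasDerivWithinAt (fun t => forcedTransport ψ g₀ r₀ T D t y)
      (ψ y * r₀ (labelMap D t y) - v t y * deriv (forcedTransport ψ g₀ r₀ T D t) y)
      (Icc 0 T) t := by
  obtain ⟨-, γ', hγ, hγ'⟩ := contDiffInSpace_forcedLabel (n := 1) (T := T) hψ hg hr hZ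
  have hy : HasDerivAt (forcedTransport ψ g₀ r₀ T D t) _ y :=
    (hγ t (labelMap D t y)).comp y (h.hasDerivAt_labelMap t y)
  have hft : HasDerivWithinAt (fun s => forcedLabel ψ g₀ r₀ T D s (labelMap D t y))
      (r₀ (labelMap D t y) * ψ (labelMap D t y + D t (labelMap D t y))) (Icc 0 T) t :=
    ((hasDerivWithinAt_integral_clampTime (h.continuous_along hψ.continuous _) ht).const_mul
      _).const_add _
  rw [h.apply_labelMap] at hft
  have := HasDerivWithinAt.comp_moving hγ hγ'.continuous hft (h.hasDerivWithinAt_labelMap ht y)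
  rw [hy.deriv]
  refine this.congr_deriv ?_
  ring

end IsFlow

/-- The derivative of the velocity consists of translates of the vorticity, so no regularity is lost
and the bootstrap closes. -/
theorem ContDiffInSpace.logVelocity_deriv {n : ℕ} {g : ℝ → ℝ → ℝ} (hg : ContDiffInSpace n g)
    (b₁ b₂ : ℝ) : ContDiffInSpace n fun t z => 2 * g t (z + b₁) - g t (z - b₂) :=
  ((ContDiffInSpace.const 2).mul
    (hg.comp (ContDiffInSpace.of_contDiff (contDiff_id.add contDiff_const)))).sub
    (hg.comp (ContDiffInSpace.of_contDiff (contDiff_id.sub contDiff_const)))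

/-- The flow and its inverse inherit the regularity of the data. -/
theorem IsFlow.contDiffInSpace {δ T b₁ b₂ : ℝ} {ψ g₀ r₀ : ℝ → ℝ} {v D : ℝ → ℝ → ℝ} {n : ℕ}
    (h : IsFlow δ T v (fun t z => 2 * forcedTransport ψ g₀ r₀ T D t (z + b₁)
      - forcedTransport ψ g₀ r₀ T D t (z - b₂)) D)
    (hψ : ContDiff ℝ n ψ) (hg : ContDiff ℝ n g₀) (hr : ContDiff ℝ n r₀) :
    ContDiffInSpace n (fun t a => a + D t a) ∧ ContDiffInSpace n (labelMap D) := by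
  suffices ∀ k ≤ n, ContDiffInSpace k (fun t a => a + D t a) ∧ ContDiffInSpace k (labelMap D) from
    this n le_rfl
  intro k
  induction k with
  | zero => exact fun _ => ⟨h.continuous_position, h.continuous_labelMap⟩
  | succ k ih =>
    intro hk
    obtain ⟨hZ, hA⟩ := ih (Nat.le_of_succ_le hk)
    have hkn : (k : WithTop ℕ∞) ≤ n := by exact_mod_cast Nat.le_of_succ_le hk
    exact h.contDiffInSpace_succ ((contDiffInSpace_forcedTransport (hψ.of_le hkn) (hg.of_le hkn)
      (hr.of_le hkn) hZ hA).logVelocity_deriv b₁ b₂) hZ hA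

/-! ### Continuity in time for the norm of `C^n` -/

theorem iteratedDeriv_eq_zero_of_eqOn {f : ℝ → ℝ} {U : Set ℝ} (hU : IsOpen U)
    (hf : ∀ x ∈ U, f x = 0) (k : ℕ) {x : ℝ} (hx : x ∈ U) : iteratedDeriv k f x = 0 := by
  have h : f =ᶠ[𝓝 x] fun _ => 0 := by
    filter_upwards [hU.mem_nhds hx] with y hy using hf y hy
  rw [h.iteratedDeriv_eq]
  simp

namespace ContDiffInSpace

variable {n : ℕ} {f g : ℝ → ℝ → ℝ}

theorem contDiff (hf : ContDiffInSpace n f) (t : ℝ) : ContDiff ℝ n (f t) := by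
  induction n generalizing f with
  | zero =>
    exact contDiff_zero.2 (Continuous.comp (f := fun x : ℝ => (t, x)) hf (by fun_prop))
  | succ n ih =>
    obtain ⟨-, f', hd, hf'⟩ := hf
    push_cast
    rw [contDiff_succ_iff_deriv]
    refine ⟨fun x => (hd t x).differentiableAt, by simp, ?_⟩
    rw [show deriv (f t) = f' t from funext fun x => (hd t x).deriv]
    exact ih hf'

theorem continuous_iteratedDeriv (hf : ContDiffInSpace n f) {k : ℕ} (hk : k ≤ n) :
    Continuous fun p : ℝ × ℝ => iteratedDeriv k (f p.1) p.2 := by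
  induction k generalizing n f with
  | zero => simpa using hf.continuous
  | succ k ih =>
    obtain ⟨n, rfl⟩ := Nat.exists_eq_add_one_of_ne_zero (Nat.ne_zero_of_lt hk)
    obtain ⟨-, f', hd, hf'⟩ := hf
    have (t : ℝ) : deriv (f t) = f' t := funext fun x => (hd t x).deriv
    simp only [iteratedDeriv_succ', this]
    exact ih hf' (Nat.le_of_succ_le_succ hk)

theorem continuous_cnNorm (hf : ContDiffInSpace n f) {c d : ℝ} (hc : 0 < c) (hd : d < 1)
    (h₀ : ∀ t x, x ∉ Icc c d → f t x = 0) : Continuous fun t => cnNorm n (f t) := by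
  refine continuous_finsetSum _ fun k hk => ?_
  have hk : k ≤ n := Nat.lt_succ_iff.1 (Finset.mem_range.1 hk)
  have hzero (t x : ℝ) (hx : x ∉ Icc c d) : iteratedDeriv k (f t) x = 0 :=
    iteratedDeriv_eq_zero_of_eqOn isClosed_Icc.isOpen_compl (fun y hy => h₀ t y hy) k hx
  -- The supremum over the line is one over a fixed compact set, and so depends continuously on `t`.
  -- Points off `[c, d]` give the value `0`, which is also taken at `0`.
  have hsup (t : ℝ) : ⨆ x, |iteratedDeriv k (f t) x|
      = sSup ((fun x => |iteratedDeriv k (f t) x|) '' Icc 0 1) := by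
    rw [iSup]
    congr 1
    refine (range_subset_iff.2 fun x => ?_).antisymm (image_subset_range _ _)
    by_cases hx : x ∈ Icc c d
    · exact ⟨x, ⟨hc.le.trans hx.1, hx.2.trans hd.le⟩, rfl⟩
    · refine ⟨0, ⟨le_rfl, zero_le_one⟩, ?_⟩
      simp only [hzero t x hx, hzero t 0 fun h => hc.not_ge h.1]
  simp only [hsup]
  exact isCompact_Icc.continuous_sSup (hf.continuous_iteratedDeriv hk).abs

theorem continuousInK (hf : ContDiffInSpace n f) {c d : ℝ} (hc : 0 < c) (hd : d < 1)
    (h₀ : ∀ t x, x ∉ Icc c d → f t x = 0) (J : Set ℝ) : ContinuousInK n J f := by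
  have hsupp (t : ℝ) : tsupport (f t) ⊆ Icc c d :=
    closure_minimal (fun x hx => by_contra fun h => hx (h₀ t x h)) isClosed_Icc
  refine ⟨fun t _ => ⟨hf.contDiff t, ?_, (hsupp t).trans (Icc_subset_Ioo hc hd)⟩, fun t _ => ?_,
    fun t _ => ⟨cnNorm n (f t) + 1 + c⁻¹, ?_⟩⟩
  · exact isCompact_Icc.of_isClosed_subset (isClosed_tsupport _) (hsupp t)
  · have hsub := (hf.sub (ContDiffInSpace.of_contDiff (hf.contDiff t))).continuous_cnNorm hc hd
      (fun s x hx => by simp [h₀ s x hx, h₀ t x hx])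
    have := (hsub.tendsto t).mono_left (nhdsWithin_le_nhds (s := J))
    have h₁ : cnNorm n (fun x => f t x - f t x) = 0 := by simp [cnNorm]
    rw [h₁] at this
    exact this
  · have := (hf.continuous_cnNorm hc hd h₀).tendsto t
    filter_upwards [nhdsWithin_le_nhds (this.eventually_lt_const (lt_add_one _))] with s hs
    refine add_le_add hs.le ?_
    rcases (tsupport (f s)).eq_empty_or_nonempty with h | h
    · simp [h, hc.le]
    · exact inv_anti₀ hc (le_csInf h fun x hx => (hsupp s hx).1)

end ContDiffInSpace

/-! ### Return to the variable `x` -/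

/-- The function of `x` that is given by `g` in the variable `log x`, for `g` supported in
`(c, ∞)`. -/
noncomputable def ofLog (c : ℝ) (g : ℝ → ℝ) (x : ℝ) : ℝ := g (Real.log (max x (Real.exp c)))

theorem ofLog_apply {c : ℝ} {g : ℝ → ℝ} (hg : ∀ z ≤ c, g z = 0) {x : ℝ} (hx : 0 < x) :
    ofLog c g x = g (Real.log x) := by
  unfold ofLog
  rcases le_total x (Real.exp c) with h | h
  · rw [max_eq_right h, Real.log_exp, hg c le_rfl, hg _ ((Real.log_le_iff_le_exp hx).2 h)]
  · rw [max_eq_left h]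

theorem ofLog_eq_zero {c : ℝ} {g : ℝ → ℝ} {x a b : ℝ} (hca : c < a)
    (hg : ∀ z, z ∉ Icc a b → g z = 0) (hx : x ∉ Icc (Real.exp a) (Real.exp b)) :
    ofLog c g x = 0 := by
  refine hg _ fun h => hx ?_
  have hpos : 0 < max x (Real.exp c) := lt_max_of_lt_right (Real.exp_pos c)
  have h₁ := (Real.le_log_iff_exp_le hpos).1 h.1
  have h₂ := (Real.log_le_iff_le_exp hpos).1 h.2
  refine ⟨?_, (le_max_left _ _).trans h₂⟩
  exact (le_max_iff.1 h₁).resolve_right (Real.exp_lt_exp.2 hca).not_ge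

/-- The derivative of `g (log x)` is again of this form, with `g' z * exp (-z)` in place of `g`, so
induction applies. For `x < exp a`, nonpositive `x` included, everything vanishes. -/
theorem ContDiffInSpace.comp_ofLog {n : ℕ} {g : ℝ → ℝ → ℝ} (hg : ContDiffInSpace n g) {a b c : ℝ}
    (hca : c < a) (h₀ : ∀ t z, z ∉ Icc a b → g t z = 0) :
    ContDiffInSpace n fun t => ofLog c (g t) := by
  have hpos (x : ℝ) : 0 < max x (Real.exp c) := lt_max_of_lt_right (Real.exp_pos c)
  have hcont {h : ℝ → ℝ → ℝ} (hh : Continuous fun p : ℝ × ℝ => h p.1 p.2) :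
      Continuous fun p : ℝ × ℝ => ofLog c (h p.1) p.2 := by
    have hlog : Continuous fun x => Real.log (max x (Real.exp c)) :=
      (continuous_id.max continuous_const).log fun x => (hpos x).ne'
    exact hh.comp (f := fun p : ℝ × ℝ => (p.1, Real.log (max p.2 (Real.exp c))))
      (continuous_fst.prodMk (hlog.comp continuous_snd))
  induction n generalizing g with
  | zero => exact hcont hg
  | succ n ih =>
    obtain ⟨hc, g', hd, hg'⟩ := hg
    have h₀' (t z : ℝ) (hz : z ∉ Icc a b) : g' t z = 0 := by
      rw [← (hd t z).deriv, ← iteratedDeriv_one]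
      exact iteratedDeriv_eq_zero_of_eqOn isClosed_Icc.isOpen_compl (fun y hy => h₀ t y hy) 1 hz
    have hle {h : ℝ → ℝ} (hh : ∀ z, z ∉ Icc a b → h z = 0) (z : ℝ) (hz : z ≤ c) : h z = 0 :=
      hh z fun h => (hca.trans_le h.1).not_ge hz
    refine ⟨hcont hc, fun t => ofLog c fun z => g' t z * Real.exp (-z), fun t x => ?_, ?_⟩
    · have h' (z : ℝ) (hz : z ∉ Icc a b) : g' t z * Real.exp (-z) = 0 := by
        rw [h₀' t z hz, zero_mul]
      change HasDerivAt (ofLog c (g t)) (ofLog c (fun z => g' t z * Real.exp (-z)) x) x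
      rcases lt_or_ge 0 x with hx | hx
      · have h₁ : HasDerivAt (fun x => g t (Real.log x)) (g' t (Real.log x) * x⁻¹) x :=
          (hd t _).comp x (Real.hasDerivAt_log hx.ne')
        rw [ofLog_apply (hle h') hx, Real.exp_neg,
          Real.exp_log hx]
        refine h₁.congr_of_eventuallyEq ?_
        filter_upwards [lt_mem_nhds hx] with y hy using ofLog_apply (hle (h₀ t)) hy
      · have hxa : x < Real.exp a := hx.trans_lt (Real.exp_pos a)
        rw [ofLog_eq_zero hca h' fun h => hxa.not_ge h.1]
        refine (hasDerivAt_const x 0).congr_of_eventuallyEq ?_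
        filter_upwards [gt_mem_nhds hxa] with y hy
        exact ofLog_eq_zero hca (h₀ t) fun h => hy.not_ge h.1
    · refine ih (hg'.mul (ContDiffInSpace.of_contDiff (Real.contDiff_exp.comp contDiff_neg)))
        fun t z hz => ?_
      rw [h₀' t z hz, zero_mul]

theorem hasDerivAt_ofLog {c : ℝ} {g : ℝ → ℝ} (h₀ : ∀ z ≤ c, g z = 0) {x : ℝ} (hx : 0 < x)
    (hg : DifferentiableAt ℝ g (Real.log x)) :
    HasDerivAt (ofLog c g) (deriv g (Real.log x) * x⁻¹) x := by
  refine (hg.hasDerivAt.comp x (Real.hasDerivAt_log hx.ne')).congr_of_eventuallyEq ?_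
  filter_upwards [lt_mem_nhds hx] with y hy using ofLog_apply h₀ hy

theorem integral_ofLog_div {c : ℝ} {g : ℝ → ℝ} (hc : Continuous g) (h₀ : ∀ z ≤ c, g z = 0)
    {a b : ℝ} (ha : 0 < a) (hb : 0 < b) :
    ∫ y in a..b, ofLog c g y / y
      = (∫ z in c..Real.log b, g z) - ∫ z in c..Real.log a, g z := by
  have hpos (y : ℝ) (hy : y ∈ uIcc a b) : 0 < y := (lt_min ha hb).trans_le hy.1
  have hcongr : ∫ y in a..b, ofLog c g y / y = ∫ y in a..b, g (Real.log y) * y⁻¹ :=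
    intervalIntegral.integral_congr fun y hy => by
      simp only [ofLog_apply h₀ (hpos y hy), div_eq_mul_inv]
  rw [hcongr]
  refine intervalIntegral.integral_eq_sub_of_hasDerivAt
    (f := fun y => ∫ z in c..Real.log y, g z) (fun y hy => ?_) ?_
  · exact (intervalIntegral.integral_hasDerivAt_right (hc.intervalIntegrable c (Real.log y))
      (hc.stronglyMeasurableAtFilter _ _) hc.continuousAt).comp y
      (Real.hasDerivAt_log (hpos y hy).ne')
  · refine ContinuousOn.intervalIntegrable fun y hy => ContinuousAt.continuousWithinAt ?_
    have hy' := (hpos y hy).ne'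
    exact (hc.continuousAt.comp (Real.continuousAt_log hy')).mul (continuousAt_inv₀ hy')

/-- With `dy / y = dz` the limits become `z - b₂`, `z + b₁` and `0`. The integral up to `z + b₁`
occurs in both terms of the law, whence the factor `2` in `logVelocity`. -/
theorem velocity_ofLog {β₁ β₂ c x : ℝ} {g : ℝ → ℝ} (hβ₂ : 0 < β₂) (hβ₁ : 1 ≤ β₁)
    (hc : Continuous g) (hc₀ : c ≤ 0) (h₀ : ∀ z, z ∉ Ioo c 0 → g z = 0) (hx : x ∈ Ioo (0 : ℝ) 1) :
    velocity β₁ β₂ (ofLog c g) x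
      = x * logVelocity (Real.log β₁) (-Real.log β₂) c g (Real.log x) := by
  have hle (z : ℝ) (hz : z ≤ c) : g z = 0 := h₀ z fun h => h.1.not_ge hz
  have hβ₁' : 0 < β₁ := zero_lt_one.trans_le hβ₁
  have hmin (y : ℝ) : ∫ z in c..min y 0, g z = ∫ z in c..y, g z := by
    rw [integral_eq_integral_clamp hc hc₀ h₀ y, integral_eq_integral_clamp hc hc₀ h₀ (min y 0),
      min_assoc, min_self]
  have hlog {y : ℝ} (hy : 0 < y) : Real.log (min y 1) = min (Real.log y) 0 := by
    rcases le_total y 1 with h | h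
    · rw [min_eq_left h, min_eq_left (Real.log_nonpos hy.le h)]
    · rw [min_eq_right h, min_eq_right (Real.log_nonneg h), Real.log_one]
  have h₁ : 0 < β₁ * x := mul_pos hβ₁' hx.1
  have h₂ : 0 < β₂ * x := mul_pos hβ₂ hx.1
  unfold velocity logVelocity
  rw [integral_ofLog_div hc hle (lt_min h₂ one_pos) (lt_min h₁ one_pos),
    integral_ofLog_div hc hle (lt_min h₁ one_pos) one_pos, hlog h₁, hlog h₂, hmin, hmin,
    Real.log_mul hβ₁'.ne' hx.1.ne', Real.log_mul hβ₂.ne' hx.1.ne', Real.log_one, sub_neg_eq_add,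
    add_comm (Real.log β₁), add_comm (Real.log β₂)]
  ring

/-! ### Consequences of bounds in `K^n` -/

theorem abs_iteratedDeriv_le_cnNorm {n : ℕ} {f : ℝ → ℝ} (hf : ContDiff ℝ n f)
    (hs : HasCompactSupport f) {k : ℕ} (hk : k ≤ n) (x : ℝ) :
    |iteratedDeriv k f x| ≤ cnNorm n f := by
  have hle : |iteratedDeriv k f x| ≤ ⨆ x, |iteratedDeriv k f x| := by
    have hc : Continuous (iteratedDeriv k f) :=
      hf.continuous_iteratedDeriv k (by exact_mod_cast hk)
    obtain ⟨C, hC⟩ := hc.bounded_above_of_compact_support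
      (HasCompactSupport.intro hs fun x hx => iteratedDeriv_eq_zero_of_eqOn
        (isClosed_tsupport f).isOpen_compl (fun y hy => image_eq_zero_of_notMem_tsupport hy) k hx)
    exact le_ciSup (f := fun x => |iteratedDeriv k f x|) ⟨C, forall_mem_range.2 hC⟩ x
  refine hle.trans (Finset.single_le_sum (f := fun k => ⨆ x, |iteratedDeriv k f x|)
    (fun i _ => Real.iSup_nonneg fun _ => abs_nonneg _) (Finset.mem_range.2 (by lia)))

theorem cnNorm_nonneg (n : ℕ) (f : ℝ → ℝ) : 0 ≤ cnNorm n f :=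
  Finset.sum_nonneg fun _ _ => Real.iSup_nonneg fun _ => abs_nonneg _

namespace MemK

variable {n : ℕ} {f : ℝ → ℝ} {M : ℝ}

theorem mem_Ioo (hf : MemK n f) {x : ℝ} (hx : f x ≠ 0) : x ∈ Ioo (0 : ℝ) 1 :=
  hf.tsupport_subset (subset_tsupport f hx)

theorem sInf_tsupport_nonneg (hf : MemK n f) : 0 ≤ sInf (tsupport f) :=
  Real.sInf_nonneg fun _ hx => (hf.tsupport_subset hx).1.le

theorem abs_deriv_le (hf : MemK n f) (hn : 1 ≤ n) (hM : kNorm n f ≤ M) (x : ℝ) :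
    |deriv f x| ≤ M := by
  rw [← iteratedDeriv_one]
  refine (abs_iteratedDeriv_le_cnNorm hf.contDiff hf.hasCompactSupport hn x).trans
    (le_trans ?_ hM)
  exact le_add_of_nonneg_right (inv_nonneg.2 hf.sInf_tsupport_nonneg)

theorem inv_le (hf : MemK n f) (hM : kNorm n f ≤ M) {x : ℝ} (hx : f x ≠ 0) : x⁻¹ ≤ M := by
  have hmem : x ∈ tsupport f := subset_tsupport f hx
  have hpos : 0 < sInf (tsupport f) :=
    (hf.tsupport_subset (hf.hasCompactSupport.isCompact.sInf_mem ⟨x, hmem⟩)).1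
  have hle : sInf (tsupport f) ≤ x := csInf_le hf.hasCompactSupport.isCompact.bddBelow hmem
  refine (inv_anti₀ hpos hle).trans (le_trans ?_ hM)
  exact le_add_of_nonneg_left (cnNorm_nonneg n f)

theorem exists_Icc (hf : MemK n f) :
    ∃ c d, 0 < c ∧ c ≤ d ∧ d < 1 ∧ ∀ x, x ∉ Icc c d → f x = 0 := by
  rcases (tsupport f).eq_empty_or_nonempty with h | h
  · refine ⟨1 / 2, 1 / 2, by norm_num, le_rfl, by norm_num, fun x _ => ?_⟩
    exact image_eq_zero_of_notMem_tsupport (by simp [h])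
  · have hK := hf.hasCompactSupport.isCompact
    have h₁ := hK.sInf_mem h
    refine ⟨sInf (tsupport f), sSup (tsupport f), (hf.tsupport_subset h₁).1,
      le_csSup hK.bddAbove h₁, (hf.tsupport_subset (hK.sSup_mem h)).2, fun x hx => ?_⟩
    exact image_eq_zero_of_notMem_tsupport fun hx' =>
      hx ⟨csInf_le hK.bddBelow hx', le_csSup hK.bddAbove hx'⟩

theorem mono {m : ℕ} (hf : MemK n f) (h : m ≤ n) : MemK m f :=
  ⟨hf.contDiff.of_le (by exact_mod_cast h), hf.hasCompactSupport, hf.tsupport_subset⟩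

end MemK

namespace ContinuousInK

variable {n : ℕ} {J J' : Set ℝ} {f : ℝ → ℝ → ℝ}

theorem mono (hf : ContinuousInK n J f) (h : J' ⊆ J) : ContinuousInK n J' f where
  memK t ht := hf.memK t (h ht)
  tendsto t ht := (hf.tendsto t (h ht)).mono_left (nhdsWithin_mono t h)
  locallyBounded t ht := by
    obtain ⟨M, hM⟩ := hf.locallyBounded t (h ht)
    exact ⟨M, hM.filter_mono (nhdsWithin_mono t h)⟩

theorem exists_kNorm_le (hf : ContinuousInK n J f) (hJ : IsCompact J) :
    ∃ M, ∀ t ∈ J, kNorm n (f t) ≤ M := by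
  refine hJ.induction_on (p := fun S => ∃ M, ∀ t ∈ S, kNorm n (f t) ≤ M) ⟨0, by simp⟩
    (fun S S' h ⟨M, hM⟩ => ⟨M, fun t ht => hM t (h ht)⟩)
    (fun S S' ⟨M, hM⟩ ⟨M', hM'⟩ => ⟨max M M', fun t ht => ?_⟩) (fun t ht => ?_)
  · exact ht.elim (fun h => le_max_of_le_left (hM t h)) fun h => le_max_of_le_right (hM' t h)
  · obtain ⟨M, hM⟩ := hf.locallyBounded t ht
    exact ⟨_, hM, M, fun s hs => hs⟩

theorem continuousOn (hf : ContinuousInK n J f) :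
    ContinuousOn (fun p : ℝ × ℝ => f p.1 p.2) (J ×ˢ univ) := by
  rintro ⟨t, x⟩ ⟨ht, -⟩
  rw [ContinuousWithinAt, tendsto_iff_dist_tendsto_zero, nhdsWithin_prod_eq, nhdsWithin_univ]
  have h₁ : Tendsto (fun p : ℝ × ℝ => cnNorm n (f p.1 - f t)) (𝓝[J] t ×ˢ 𝓝 x) (𝓝 0) :=
    (hf.tendsto t ht).comp tendsto_fst
  have h₂ : Tendsto (fun p : ℝ × ℝ => dist (f t p.2) (f t x)) (𝓝[J] t ×ˢ 𝓝 x) (𝓝 0) :=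
    (tendsto_iff_dist_tendsto_zero.1 ((hf.memK t ht).contDiff.continuous.tendsto x)).comp
      tendsto_snd
  refine squeeze_zero' (.of_forall fun _ => dist_nonneg) ?_ (by simpa using h₁.add h₂)
  filter_upwards [tendsto_fst.eventually (self_mem_nhdsWithin (s := J) (a := t))] with p hp
  refine (dist_triangle _ (f t p.2) _).trans (add_le_add_left ?_ _)
  have := abs_iteratedDeriv_le_cnNorm ((hf.memK _ hp).contDiff.sub (hf.memK t ht).contDiff)
    ((hf.memK _ hp).hasCompactSupport.sub (hf.memK t ht).hasCompactSupport) (Nat.zero_le n) p.2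
  rw [iteratedDeriv_zero] at this
  exact this

end ContinuousInK

/-! ### Uniqueness by a maximum principle -/

section Uniqueness

variable {β₁ β₂ : ℝ} {n : ℕ} {ω₀ ρ₀ : ℝ → ℝ} {J J' : Set ℝ} {ω₁ ρ₁ ω₂ ρ₂ : ℝ → ℝ → ℝ}

theorem IsSolution.mono (h : IsSolution β₁ β₂ n ω₀ ρ₀ J ω₁ ρ₁) (hJ : J' ⊆ J) :
    IsSolution β₁ β₂ n ω₀ ρ₀ J' ω₁ ρ₁ where
  continuousInK_vorticity := h.continuousInK_vorticity.mono hJ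
  continuousInK_density := h.continuousInK_density.mono hJ
  vorticity_equation t ht x hx := (h.vorticity_equation t (hJ ht) x hx).mono hJ
  density_equation t ht x hx := (h.density_equation t (hJ ht) x hx).mono hJ
  initial_vorticity := h.initial_vorticity
  initial_density := h.initial_density

/-- Where the vorticities differ, `1 / y` is at most `M`, so the singular weight is harmless. The
two integrals run over segments of length at most `1`, and `x < 1`. -/
theorem abs_velocity_sub_le {w₁ w₂ : ℝ → ℝ} {M N x : ℝ} (hβ₂ : 0 < β₂)
    (hβ₁ : 1 ≤ β₁) (hc₁ : Continuous w₁) (hc₂ : Continuous w₂) (hx : x ∈ Ioo (0 : ℝ) 1)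
    (hN : ∀ y, |w₁ y - w₂ y| ≤ N) (hM : ∀ y, w₁ y ≠ w₂ y → 0 < y ∧ y⁻¹ ≤ M) (hM₀ : 0 ≤ M) :
    |velocity β₁ β₂ w₁ x - velocity β₁ β₂ w₂ x| ≤ 2 * M * N := by
  have hN₀ : 0 ≤ N := (abs_nonneg _).trans (hN 0)
  have key {a b : ℝ} (ha : 0 < a) (ha₁ : a ≤ 1) (hb : 0 < b) (hb₁ : b ≤ 1) :
      |(∫ y in a..b, w₁ y / y) - ∫ y in a..b, w₂ y / y| ≤ N * M := by
    have hint {w : ℝ → ℝ} (hw : Continuous w) :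
        IntervalIntegrable (fun y => w y / y) MeasureTheory.volume a b :=
      ContinuousOn.intervalIntegrable (hw.continuousOn.div continuousOn_id fun y hy =>
        ((lt_min ha hb).trans_le hy.1).ne')
    rw [← intervalIntegral.integral_sub (hint hc₁) (hint hc₂)]
    refine (intervalIntegral.norm_integral_le_of_norm_le_const (C := N * M)
      (f := fun y => w₁ y / y - w₂ y / y) fun y _ => ?_).trans
      (mul_le_of_le_one_right (by positivity) (abs_le.2 ⟨by linarith, by linarith⟩))
    rw [← sub_div, Real.norm_eq_abs, abs_div, div_eq_mul_inv]
    by_cases h : w₁ y = w₂ y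
    · simp only [h, sub_self, abs_zero, zero_mul]; positivity
    · obtain ⟨h₁, h₂⟩ := hM y h
      rw [abs_of_pos h₁]
      exact mul_le_mul (hN y) h₂ (inv_nonneg.2 h₁.le) hN₀
  have h₁ : 0 < min (β₁ * x) 1 := lt_min (mul_pos (by linarith) hx.1) one_pos
  have h₂ : 0 < min (β₂ * x) 1 := lt_min (mul_pos hβ₂ hx.1) one_pos
  have k₁ := abs_le.1 (key h₂ (min_le_right _ _) h₁ (min_le_right _ _))
  have k₂ := abs_le.1 (key h₁ (min_le_right _ _) one_pos le_rfl)
  unfold velocity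
  have hx₁ := hx.2.le
  have hNM : 0 ≤ N * M := by positivity
  have e (a b c d : ℝ) : x * a - x * b - (x * c - x * d) = x * ((a - c) - (b - d)) := by ring
  rw [e, abs_mul, abs_of_pos hx.1]
  refine (mul_le_of_le_one_left (abs_nonneg _) hx₁).trans (abs_le.2 ⟨?_, ?_⟩) <;> linarith

/-- At a point where `exp (-K t) * f t x` attains its maximum over all positions and all times up to
`t`, a solution of a transport equation grows at least at rate `K`. -/
theorem mul_le_of_transport_max {f : ℝ → ℝ → ℝ} {K S u τ t₀ x₀ : ℝ} (ht₀ : t₀ ∈ Ioc 0 τ)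
    (hf : HasDerivWithinAt (fun s => f s x₀) (S - u * deriv (f t₀) x₀) (Icc 0 τ) t₀)
    (hx : ∀ x, f t₀ x ≤ f t₀ x₀)
    (ht : ∀ s ∈ Icc 0 τ, Real.exp (-K * s) * f s x₀ ≤ Real.exp (-K * t₀) * f t₀ x₀) :
    K * f t₀ x₀ ≤ S := by
  have hd : deriv (f t₀) x₀ = 0 := IsLocalMax.deriv_eq_zero (.of_forall hx)
  rw [hd, mul_zero, sub_zero] at hf
  have hE : HasDerivAt (fun s => Real.exp (-K * s)) (Real.exp (-K * t₀) * -K) t₀ := by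
    simpa using ((hasDerivAt_id t₀).const_mul (-K)).exp
  -- Only earlier times are compared: the left slopes of the weighted function at its maximum are
  -- nonnegative.
  have hφ := (hE.hasDerivWithinAt.mul hf).mono (s := Iio t₀ ∩ Icc 0 τ) inter_subset_right
  rw [hasDerivWithinAt_iff_tendsto_slope' fun h => lt_irrefl t₀ h.1] at hφ
  have : (𝓝[Iio t₀ ∩ Icc 0 τ] t₀).NeBot := by
    refine NeBot.mono (f := 𝓝[Ioo 0 t₀] t₀) (right_nhdsWithin_Ioo_neBot ht₀.1)
      (nhdsWithin_mono _ fun s hs => ⟨hs.2, hs.1.le, hs.2.le.trans ht₀.2⟩)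
  have hnn := ge_of_tendsto (b := 0) hφ <| by
    filter_upwards [self_mem_nhdsWithin] with s hs
    rw [slope_def_field]
    exact div_nonneg_of_nonpos (sub_nonpos.2 (ht s hs.2)) (sub_nonpos.2 (le_of_lt hs.1))
  have hfac : Real.exp (-K * t₀) * -K * f t₀ x₀ + Real.exp (-K * t₀) * S
      = Real.exp (-K * t₀) * (S - K * f t₀ x₀) := by ring
  rw [hfac] at hnn
  exact sub_nonneg.1 (nonneg_of_mul_nonneg_right hnn (Real.exp_pos _))

/-- Uniform bounds for a time slice of a solution. -/
structure SliceBound (M : ℝ) (f : ℝ → ℝ) : Prop where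
  differentiable : Differentiable ℝ f
  abs_deriv_le : ∀ x, |deriv f x| ≤ M
  support : ∀ x, f x ≠ 0 → x ∈ Ioo (0 : ℝ) 1 ∧ x⁻¹ ≤ M

theorem ContinuousInK.exists_sliceBound {f : ℝ → ℝ → ℝ} (hf : ContinuousInK n J f)
    (hJ : IsCompact J) (hn : 1 ≤ n) : ∃ M, ∀ N, M ≤ N → ∀ t ∈ J, SliceBound N (f t) := by
  obtain ⟨M, hM⟩ := hf.exists_kNorm_le hJ
  refine ⟨M, fun N hN t ht => ⟨(hf.memK t ht).contDiff.differentiable ?_,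
    (hf.memK t ht).abs_deriv_le hn ((hM t ht).trans hN), fun x hx =>
      ⟨(hf.memK t ht).mem_Ioo hx, (hf.memK t ht).inv_le ((hM t ht).trans hN) hx⟩⟩⟩
  exact_mod_cast Nat.one_le_iff_ne_zero.1 hn

theorem SliceBound.support_sub {M : ℝ} {f g : ℝ → ℝ} (hf : SliceBound M f) (hg : SliceBound M g)
    (x : ℝ) (h : f x ≠ g x) : x ∈ Ioo (0 : ℝ) 1 ∧ x⁻¹ ≤ M := by
  by_cases h₁ : f x = 0
  · exact hg.support x fun h₂ => h (h₁.trans h₂.symm)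
  · exact hf.support x h₁

/-- The weighted difference of two solutions has no positive maximum at a positive time. -/
theorem IsSolution.sub_ne_of_max {τ M K N t₀ x₀ : ℝ} (hβ₂ : 0 < β₂)
    (hβ₁ : 1 ≤ β₁) (h₁ : IsSolution β₁ β₂ n ω₀ ρ₀ (Icc 0 τ) ω₁ ρ₁)
    (h₂ : IsSolution β₁ β₂ n ω₀ ρ₀ (Icc 0 τ) ω₂ ρ₂) (ht₀ : t₀ ∈ Ioc 0 τ)
    (bω₁ : SliceBound M (ω₁ t₀)) (bω₂ : SliceBound M (ω₂ t₀))
    (bρ₁ : SliceBound M (ρ₁ t₀)) (bρ₂ : SliceBound M (ρ₂ t₀))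
    (hK : M + 2 * M ^ 2 < K) (hN : 0 < N)
    (hω : ∀ s ∈ Icc 0 τ, ∀ x, Real.exp (-K * s) * |ω₁ s x - ω₂ s x| ≤ Real.exp (-K * t₀) * N)
    (hρ : ∀ s ∈ Icc 0 τ, ∀ x, Real.exp (-K * s) * |ρ₁ s x - ρ₂ s x| ≤ Real.exp (-K * t₀) * N) :
    ω₁ t₀ x₀ - ω₂ t₀ x₀ ≠ N ∧ ρ₁ t₀ x₀ - ρ₂ t₀ x₀ ≠ N := by
  have ht₀' := Ioc_subset_Icc_self ht₀
  have hM : 0 ≤ M := (abs_nonneg _).trans (bω₁.abs_deriv_le 0)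
  have hω' (x : ℝ) : |ω₁ t₀ x - ω₂ t₀ x| ≤ N :=
    le_of_mul_le_mul_left (hω t₀ ht₀' x) (Real.exp_pos _)
  have hρ' (x : ℝ) : |ρ₁ t₀ x - ρ₂ t₀ x| ≤ N :=
    le_of_mul_le_mul_left (hρ t₀ ht₀' x) (Real.exp_pos _)
  have hu (hx₀ : x₀ ∈ Ioo (0 : ℝ) 1) := abs_velocity_sub_le hβ₂ hβ₁
    bω₁.differentiable.continuous bω₂.differentiable.continuous hx₀ hω'
    (fun y hy => ⟨(bω₁.support_sub bω₂ y hy).1.1, (bω₁.support_sub bω₂ y hy).2⟩) hM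
  have hadv {f : ℝ → ℝ} (hf : SliceBound M f) (hx₀ : x₀ ∈ Ioo (0 : ℝ) 1) :
      |(velocity β₁ β₂ (ω₁ t₀) x₀ - velocity β₁ β₂ (ω₂ t₀) x₀) * deriv f x₀| ≤ 2 * M * N * M := by
    rw [abs_mul]
    exact mul_le_mul (hu hx₀) (hf.abs_deriv_le x₀) (abs_nonneg _) (by positivity)
  have hKN : (M + 2 * M ^ 2) * N < K * N := mul_lt_mul_of_pos_right hK hN
  constructor
  · intro h
    obtain ⟨hx₀, hinv⟩ := bω₁.support_sub bω₂ x₀ fun h' => by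
      rw [sub_eq_zero.2 h'] at h; exact hN.ne h
    -- The difference of the transport terms is `u₁ ∂ₓ(ω₁ - ω₂) + (u₁ - u₂) ∂ₓω₂`. The first part
    -- drops out at the maximum, and what remains gives `K * N ≤ (M + 2 * M ^ 2) * N`, against the
    -- choice of `K`.
    have := mul_le_of_transport_max (f := fun t x => ω₁ t x - ω₂ t x) (K := K)
      (S := (ρ₁ t₀ x₀ - ρ₂ t₀ x₀) * x₀⁻¹
        - (velocity β₁ β₂ (ω₁ t₀) x₀ - velocity β₁ β₂ (ω₂ t₀) x₀) * deriv (ω₂ t₀) x₀)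
      (u := velocity β₁ β₂ (ω₁ t₀) x₀) ht₀
      (((h₁.vorticity_equation t₀ ht₀' x₀ hx₀).sub
        (h₂.vorticity_equation t₀ ht₀' x₀ hx₀)).congr_deriv (by
          rw [deriv_fun_sub (bω₁.differentiable x₀) (bω₂.differentiable x₀)]; ring))
      (fun x => ((le_abs_self _).trans (hω' x)).trans_eq h.symm)
      (fun s hs => (mul_le_mul_of_nonneg_left (le_abs_self _) (Real.exp_pos _).le).trans
        ((hω s hs x₀).trans_eq (by rw [h])))
    rw [h] at this
    have e₁ : (ρ₁ t₀ x₀ - ρ₂ t₀ x₀) * x₀⁻¹ ≤ N * M :=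
      mul_le_mul ((le_abs_self _).trans (hρ' x₀)) hinv (inv_nonneg.2 hx₀.1.le) hN.le
    have e₂ := (abs_le.1 (hadv bω₂ hx₀)).1
    nlinarith
  · intro h
    obtain ⟨hx₀, -⟩ := bρ₁.support_sub bρ₂ x₀ fun h' => by
      rw [sub_eq_zero.2 h'] at h; exact hN.ne h
    have := mul_le_of_transport_max (f := fun t x => ρ₁ t x - ρ₂ t x) (K := K)
      (S := -((velocity β₁ β₂ (ω₁ t₀) x₀ - velocity β₁ β₂ (ω₂ t₀) x₀) * deriv (ρ₂ t₀) x₀))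
      (u := velocity β₁ β₂ (ω₁ t₀) x₀) ht₀
      (((h₁.density_equation t₀ ht₀' x₀ hx₀).sub
        (h₂.density_equation t₀ ht₀' x₀ hx₀)).congr_deriv (by
          rw [deriv_fun_sub (bρ₁.differentiable x₀) (bρ₂.differentiable x₀)]; ring))
      (fun x => ((le_abs_self _).trans (hρ' x)).trans_eq h.symm)
      (fun s hs => (mul_le_mul_of_nonneg_left (le_abs_self _) (Real.exp_pos _).le).trans
        ((hρ s hs x₀).trans_eq (by rw [h])))
    rw [h] at this
    have e₂ := (abs_le.1 (hadv bρ₂ hx₀)).1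
    nlinarith [mul_nonneg hM hN.le]

theorem IsSolution.unique {τ : ℝ} (hβ₂ : 0 < β₂) (hβ₁ : 1 ≤ β₁) (hn : 1 ≤ n)
    (hτ : 0 ≤ τ) (h₁ : IsSolution β₁ β₂ n ω₀ ρ₀ (Icc 0 τ) ω₁ ρ₁)
    (h₂ : IsSolution β₁ β₂ n ω₀ ρ₀ (Icc 0 τ) ω₂ ρ₂) {t : ℝ} (ht : t ∈ Icc 0 τ) :
    ω₁ t = ω₂ t ∧ ρ₁ t = ρ₂ t := by
  obtain ⟨M, bω₁, bω₂, bρ₁, bρ₂⟩ : ∃ M, (∀ t ∈ Icc 0 τ, SliceBound M (ω₁ t)) ∧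
      (∀ t ∈ Icc 0 τ, SliceBound M (ω₂ t)) ∧ (∀ t ∈ Icc 0 τ, SliceBound M (ρ₁ t)) ∧
      ∀ t ∈ Icc 0 τ, SliceBound M (ρ₂ t) := by
    obtain ⟨M₁, hM₁⟩ := h₁.continuousInK_vorticity.exists_sliceBound isCompact_Icc hn
    obtain ⟨M₂, hM₂⟩ := h₂.continuousInK_vorticity.exists_sliceBound isCompact_Icc hn
    obtain ⟨M₃, hM₃⟩ := h₁.continuousInK_density.exists_sliceBound isCompact_Icc hn
    obtain ⟨M₄, hM₄⟩ := h₂.continuousInK_density.exists_sliceBound isCompact_Icc hn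
    exact ⟨max (max M₁ M₂) (max M₃ M₄), hM₁ _ (by simp), hM₂ _ (by simp), hM₃ _ (by simp),
      hM₄ _ (by simp)⟩
  obtain ⟨K, hK⟩ := exists_gt (M + 2 * M ^ 2)
  set W : ℝ × ℝ → ℝ := fun p =>
    Real.exp (-K * p.1) * max |ω₁ p.1 p.2 - ω₂ p.1 p.2| |ρ₁ p.1 p.2 - ρ₂ p.1 p.2| with hW
  have hWc : ContinuousOn W (Icc 0 τ ×ˢ Icc 0 1) := by
    have hsub : Icc 0 τ ×ˢ Icc (0 : ℝ) 1 ⊆ Icc 0 τ ×ˢ univ := prod_mono_right (subset_univ _)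
    refine ContinuousOn.mul (by fun_prop) (ContinuousOn.sup ?_ ?_)
    · exact ((h₁.continuousInK_vorticity.continuousOn.mono hsub).sub
        (h₂.continuousInK_vorticity.continuousOn.mono hsub)).abs
    · exact ((h₁.continuousInK_density.continuousOn.mono hsub).sub
        (h₂.continuousInK_density.continuousOn.mono hsub)).abs
  obtain ⟨⟨t₀, x₀⟩, ⟨ht₀, hx₀⟩, hmax⟩ := (isCompact_Icc.prod isCompact_Icc).exists_isMaxOn
    ⟨((0 : ℝ), (0 : ℝ)), ⟨le_rfl, hτ⟩, ⟨le_rfl, zero_le_one⟩⟩ hWc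
  replace ht₀ : t₀ ∈ Icc 0 τ := ht₀
  set N := max |ω₁ t₀ x₀ - ω₂ t₀ x₀| |ρ₁ t₀ x₀ - ρ₂ t₀ x₀| with hN
  have hN₀ : 0 ≤ N := le_max_of_le_left (abs_nonneg _)
  have hle (s : ℝ) (hs : s ∈ Icc 0 τ) (x : ℝ) : W (s, x) ≤ Real.exp (-K * t₀) * N := by
    by_cases hx : x ∈ Icc (0 : ℝ) 1
    · exact hmax ⟨hs, hx⟩
    · have hω : ω₁ s x = ω₂ s x := by_contra fun h =>
        hx (Ioo_subset_Icc_self ((bω₁ s hs).support_sub (bω₂ s hs) x h).1)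
      have hρ : ρ₁ s x = ρ₂ s x := by_contra fun h =>
        hx (Ioo_subset_Icc_self ((bρ₁ s hs).support_sub (bρ₂ s hs) x h).1)
      simp only [hW, hω, hρ, sub_self, abs_zero, max_self, mul_zero]
      positivity
  have hω (s : ℝ) (hs : s ∈ Icc 0 τ) (x : ℝ) :
      Real.exp (-K * s) * |ω₁ s x - ω₂ s x| ≤ Real.exp (-K * t₀) * N :=
    (mul_le_mul_of_nonneg_left (le_max_left _ _) (Real.exp_pos _).le).trans (hle s hs x)
  have hρ (s : ℝ) (hs : s ∈ Icc 0 τ) (x : ℝ) :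
      Real.exp (-K * s) * |ρ₁ s x - ρ₂ s x| ≤ Real.exp (-K * t₀) * N :=
    (mul_le_mul_of_nonneg_left (le_max_right _ _) (Real.exp_pos _).le).trans (hle s hs x)
  rcases hN₀.eq_or_lt with h₀ | h₀
  · rw [← h₀, mul_zero] at hω hρ
    have hzero {a b s : ℝ} (h : Real.exp (-K * s) * |a - b| ≤ 0) : a = b :=
      sub_eq_zero.1 (abs_nonpos_iff.1 (nonpos_of_mul_nonpos_right h (Real.exp_pos _)))
    exact ⟨funext fun x => hzero (hω t ht x), funext fun x => hzero (hρ t ht x)⟩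
  · exfalso
    have ht₀' : t₀ ∈ Ioc 0 τ := by
      refine ⟨ht₀.1.lt_of_ne fun h => h₀.ne' ?_, ht₀.2⟩
      rw [hN, ← h, h₁.initial_vorticity, h₂.initial_vorticity, h₁.initial_density,
        h₂.initial_density]
      simp
    have key := h₁.sub_ne_of_max (x₀ := x₀) hβ₂ hβ₁ h₂ ht₀' (bω₁ _ ht₀) (bω₂ _ ht₀)
      (bρ₁ _ ht₀) (bρ₂ _ ht₀) hK h₀ hω hρ
    -- Exchanging the two solutions treats the case where the difference at the maximum of its
    -- absolute value is negative.
    have key' := h₂.sub_ne_of_max (x₀ := x₀) hβ₂ hβ₁ h₁ ht₀' (bω₂ _ ht₀) (bω₁ _ ht₀)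
      (bρ₂ _ ht₀) (bρ₁ _ ht₀) hK h₀ (by simpa only [abs_sub_comm] using hω)
      (by simpa only [abs_sub_comm] using hρ)
    have hcase {a b : ℝ} (hab : a - b ≠ N) (hba : b - a ≠ N) : N ≠ |a - b| := by
      intro h
      rcases abs_choice (a - b) with h' | h' <;> rw [h'] at h
      · exact hab h.symm
      · exact hba (by linarith)
    rcases max_choice |ω₁ t₀ x₀ - ω₂ t₀ x₀| |ρ₁ t₀ x₀ - ρ₂ t₀ x₀| with h | h
    · exact hcase key.1 key'.1 h
    · exact hcase key.2 key'.2 h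

end Uniqueness

/-! ### Existence and the main theorem -/

theorem forcedTransport_congr {ψ φ g₀ r₀ : ℝ → ℝ} {T : ℝ} {D : ℝ → ℝ → ℝ}
    (h : ∀ s a, r₀ a ≠ 0 → ψ (a + D s a) = φ (a + D s a)) :
    forcedTransport ψ g₀ r₀ T D = forcedTransport φ g₀ r₀ T D := by
  ext t y
  unfold forcedTransport forcedLabel
  by_cases h₀ : r₀ (labelMap D t y) = 0
  · simp only [h₀, zero_mul]
  · simp only [h _ _ h₀]

theorem boundedLipschitz_of_contDiff {f : ℝ → ℝ} (hf : ContDiff ℝ 1 f)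
    (hs : HasCompactSupport f) : ∃ M, BoundedLipschitz M f := by
  obtain ⟨C, hC⟩ := hf.continuous.bounded_above_of_compact_support hs
  obtain ⟨L, hL⟩ := hf.lipschitzWith_of_hasCompactSupport hs (by simp)
  have h₁ : BoundedLipschitz (max C L) f := by
    refine ⟨fun x => (hC x).trans (le_max_left _ _), fun x y => ?_⟩
    have := hL.dist_le_mul x y
    rw [Real.dist_eq, Real.dist_eq] at this
    exact this.trans (mul_le_mul_of_nonneg_right (le_max_right _ _) (abs_nonneg _))
  exact ⟨_, h₁⟩

/-- In the variable `z` the weight `1 / x` is `exp (-z)`, unbounded at `-∞`. The contraction needs a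
bounded Lipschitz weight, so it is frozen below `c`, a region that particles carrying density never
enter. -/
theorem boundedLipschitz_exp_neg_max (c : ℝ) :
    BoundedLipschitz (Real.exp (-c)) fun x => Real.exp (-max x c) := by
  refine ⟨fun x => ?_, fun x y => ?_⟩
  · rw [Real.abs_exp, Real.exp_le_exp]
    exact neg_le_neg (le_max_right _ _)
  · have := Convex.norm_image_sub_le_of_norm_hasDerivWithin_le (s := Ici c)
      (f := fun x => Real.exp (-x)) (f' := fun x => Real.exp (-x) * -1) (C := Real.exp (-c))
      (fun x _ => (hasDerivAt_neg x).exp.hasDerivWithinAt) (fun x hx => ?_) (convex_Ici c)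
      (le_max_right y c) (le_max_right x c)
    · refine this.trans (mul_le_mul_of_nonneg_left ?_ (Real.exp_pos _).le)
      exact abs_max_sub_max_le_abs x y c
    · rw [mul_neg_one, norm_neg, Real.norm_eq_abs, Real.abs_exp, Real.exp_le_exp]
      exact neg_le_neg hx

theorem exists_isSolution {β₁ β₂ : ℝ} {ω₀ ρ₀ : ℝ → ℝ} (hβ₂ : 0 < β₂) (hβ₁ : 1 ≤ β₁)
    (hω₀ : MemK 1 ω₀) (hρ₀ : MemK 1 ρ₀) :
    ∃ T, 0 < T ∧ ∃ ω ρ : ℝ → ℝ → ℝ, ∀ n, 1 ≤ n → MemK n ω₀ → MemK n ρ₀ →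
      IsSolution β₁ β₂ n ω₀ ρ₀ (Icc 0 T) ω ρ := by
  obtain ⟨δ, c, hδ, hc, hsω, hsρ⟩ : ∃ δ c : ℝ, 0 < δ ∧ c < -δ ∧
      (∀ x, x ∉ Icc (Real.exp (c + 2 * δ)) (Real.exp (-2 * δ)) → ω₀ x = 0) ∧
      ∀ x, x ∉ Icc (Real.exp (c + 2 * δ)) (Real.exp (-2 * δ)) → ρ₀ x = 0 := by
    obtain ⟨c₁, d₁, hc₁, hcd₁, hd₁, h₁⟩ := hω₀.exists_Icc
    obtain ⟨c₂, d₂, hc₂, hcd₂, hd₂, h₂⟩ := hρ₀.exists_Icc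
    have hd : max d₁ d₂ < 1 := max_lt hd₁ hd₂
    have hc : 0 < min c₁ c₂ := lt_min hc₁ hc₂
    have hcd : min c₁ c₂ ≤ max d₁ d₂ := (min_le_left _ _).trans (hcd₁.trans (le_max_left _ _))
    have hd₀ : 0 < max d₁ d₂ := hc.trans_le hcd
    have hlog := Real.log_neg hd₀ hd
    have hlog' := Real.log_le_log hc hcd
    have e₁ : Real.exp
        (Real.log (min c₁ c₂) + Real.log (max d₁ d₂) + 2 * (-Real.log (max d₁ d₂) / 2))
        = min c₁ c₂ := by
      rw [← Real.exp_log hc]; congr 1; rw [Real.exp_log hc]; ring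
    have e₂ : Real.exp (-2 * (-Real.log (max d₁ d₂) / 2)) = max d₁ d₂ := by
      rw [← Real.exp_log hd₀]; congr 1; rw [Real.exp_log hd₀]; ring
    -- Chosen so that `exp (-2 * δ)` and `exp (c + 2 * δ)` are the ends of an interval containing
    -- both supports.
    refine ⟨-Real.log (max d₁ d₂) / 2, Real.log (min c₁ c₂) + Real.log (max d₁ d₂), by linarith,
      by linarith, fun x hx => h₁ x fun h => hx ?_, fun x hx => h₂ x fun h => hx ?_⟩ <;>
      rw [e₁, e₂]
    · exact ⟨(min_le_left _ _).trans h.1, h.2.trans (le_max_left _ _)⟩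
    · exact ⟨(min_le_right _ _).trans h.1, h.2.trans (le_max_right _ _)⟩
  set g₀ : ℝ → ℝ := fun z => ω₀ (Real.exp z) with hg₀
  set r₀ : ℝ → ℝ := fun z => ρ₀ (Real.exp z) with hr₀
  have hsg (z : ℝ) (hz : z ∉ Icc (c + 2 * δ) (-2 * δ)) : g₀ z = 0 :=
    hsω _ fun h => hz ⟨Real.exp_le_exp.1 h.1, Real.exp_le_exp.1 h.2⟩
  have hsr (z : ℝ) (hz : z ∉ Icc (c + 2 * δ) (-2 * δ)) : r₀ z = 0 :=
    hsρ _ fun h => hz ⟨Real.exp_le_exp.1 h.1, Real.exp_le_exp.1 h.2⟩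
  have hcg {n : ℕ} (h : MemK n ω₀) : ContDiff ℝ n g₀ := h.contDiff.comp Real.contDiff_exp
  have hcr {n : ℕ} (h : MemK n ρ₀) : ContDiff ℝ n r₀ := h.contDiff.comp Real.contDiff_exp
  obtain ⟨M₁, hM₁⟩ := boundedLipschitz_of_contDiff (hcg hω₀)
    (HasCompactSupport.intro isCompact_Icc hsg)
  obtain ⟨M₂, hM₂⟩ := boundedLipschitz_of_contDiff (hcr hρ₀)
    (HasCompactSupport.intro isCompact_Icc hsr)
  obtain ⟨T, hT, D, hD, hflow⟩ := exists_flow_displacement (b₁ := Real.log β₁)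
    (b₂ := -Real.log β₂) (M := max (Real.exp (-c)) (max M₁ M₂)) hδ hc
    ((boundedLipschitz_exp_neg_max c).mono (le_max_left _ _)) (hM₁.mono (by simp))
    (hM₂.mono (by simp)) hsg hsr
  -- Labels with density start above `c + 2 * δ` and move by at most `δ`, so the truncation of the
  -- weight is invisible.
  rw [forcedTransport_congr (φ := fun x => Real.exp (-x)) fun s a ha => by
    have h₁ : a ∈ Icc (c + 2 * δ) (-2 * δ) := by_contra fun h => ha (hsr a h)
    have h₂ := (abs_le.1 (hD.abs_le s a)).1
    simp only [max_eq_left (show c ≤ a + D s a by linarith [h₁.1])]] at hflow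
  have hψ {n : ℕ} : ContDiff ℝ n fun x : ℝ => Real.exp (-x) :=
    Real.contDiff_exp.comp contDiff_neg
  set g := forcedTransport (fun x => Real.exp (-x)) g₀ r₀ T D with hg
  -- The density is the same construction with initial value `r₀` and no forcing.
  set r := forcedTransport (fun x => Real.exp (-x)) r₀ 0 T D with hr
  have hr_apply (t y : ℝ) : r t y = r₀ (labelMap D t y) := by
    simp [hr, forcedTransport, forcedLabel]
  have hgs (t z : ℝ) (hz : z ∉ Icc (c + δ) (-δ)) : g t z = 0 := by
    refine hD.forcedTransport_eq_zero (fun x hx => hsg x fun h => hx ?_)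
      (fun x hx => hsr x fun h => hx ?_) t z hz <;>
    exact ⟨by linarith [h.1], by linarith [h.2]⟩
  have hrs (t z : ℝ) (hz : z ∉ Icc (c + δ) (-δ)) : r t z = 0 := by
    refine hD.forcedTransport_eq_zero (fun x hx => hsr x fun h => hx ?_)
      (fun x _ => rfl) t z hz
    exact ⟨by linarith [h.1], by linarith [h.2]⟩
  have hgc : Continuous fun p : ℝ × ℝ => g p.1 p.2 :=
    hD.continuous_forcedTransport (hψ (n := 0)).continuous hM₁.continuous hM₂.continuous
  have hgt (t : ℝ) : Continuous (g t) := hgc.comp (f := fun y : ℝ => (t, y)) (by fun_prop)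
  have hF : IsFlow δ T (fun t => logVelocity (Real.log β₁) (-Real.log β₂) c (g t))
      (fun t z => 2 * g t (z + Real.log β₁) - g t (z - -Real.log β₂)) D :=
    { hD with
      nonneg := hT.le
      continuous_velocity := continuous_logVelocity hgc
      continuous_deriv :=
        (ContDiffInSpace.logVelocity_deriv (n := 0) hgc _ _).continuous
      hasDerivAt := fun t z => hasDerivAt_logVelocity (hgt t) z
      eq_integral := hflow }
  have hgle (t z : ℝ) (hz : z ≤ c) : g t z = 0 := hgs t z fun h => by linarith [h.1]
  have hrle (t z : ℝ) (hz : z ≤ c) : r t z = 0 := hrs t z fun h => by linarith [h.1]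
  have hZ₁ := hF.contDiffInSpace (n := 1) hψ (hcg hω₀) (hcr hρ₀)
  have hvel (t x : ℝ) (hx : x ∈ Ioo (0 : ℝ) 1) : velocity β₁ β₂ (ofLog c (g t)) x
      = x * logVelocity (Real.log β₁) (-Real.log β₂) c (g t) (Real.log x) :=
    velocity_ofLog hβ₂ hβ₁ (hgt t) (by linarith) (fun z hz => hgs t z fun h =>
      hz ⟨by linarith [h.1], by linarith [h.2]⟩) hx
  have hzero {f : ℝ → ℝ} (hf : ∀ x, x ∉ Icc (Real.exp (c + 2 * δ)) (Real.exp (-2 * δ)) → f x = 0) :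
      ofLog c (fun z => f (Real.exp z)) = f := by
    ext x
    have hpos : 0 < max x (Real.exp c) := lt_max_of_lt_right (Real.exp_pos c)
    simp only [ofLog, Real.exp_log hpos]
    rcases le_total x (Real.exp c) with h | h
    · have hlt : Real.exp c < Real.exp (c + 2 * δ) := Real.exp_lt_exp.2 (by linarith)
      rw [max_eq_right h, hf _ fun h' => hlt.not_ge h'.1, hf x fun h' => by linarith [h'.1]]
    · rw [max_eq_left h]
  have hlabel (y : ℝ) : labelMap D 0 y = y := by
    have h₀ : D 0 y = 0 := by
      rw [hF.eq_integral, clampTime_of_mem ⟨le_rfl, hT.le⟩, intervalIntegral.integral_same]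
    have := hD.labelMap_apply 0 y
    rwa [h₀, add_zero] at this
  -- The time and the solution were built from `C^1` data alone; `n` enters only now, through
  -- regularity.
  refine ⟨T, hT, fun t => ofLog c (g t), fun t => ofLog c (r t), fun n _ hω hρ => ?_⟩
  obtain ⟨hZ, hA⟩ := hF.contDiffInSpace (n := n) hψ (hcg hω) (hcr hρ)
  have hgn : ContDiffInSpace n g :=
    IsFlow.contDiffInSpace_forcedTransport hψ (hcg hω) (hcr hρ) hZ hA
  have hrn : ContDiffInSpace n r :=
    IsFlow.contDiffInSpace_forcedTransport hψ (hcr hρ) contDiff_const hZ hA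
  have hdiff {f : ℝ → ℝ → ℝ} (hf : ContDiffInSpace 1 f) (t z : ℝ) : DifferentiableAt ℝ (f t) z :=
    (hf.contDiff t).differentiable (by simp) z
  have hg₁ : ContDiffInSpace 1 g :=
    IsFlow.contDiffInSpace_forcedTransport hψ (hcg hω₀) (hcr hρ₀) hZ₁.1 hZ₁.2
  have hr₁ : ContDiffInSpace 1 r :=
    IsFlow.contDiffInSpace_forcedTransport hψ (hcr hρ₀) contDiff_const hZ₁.1 hZ₁.2
  have hd₁ : Real.exp (-δ) < 1 := by
    rw [← Real.exp_zero]; exact Real.exp_lt_exp.2 (by linarith)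
  refine ⟨?_, ?_, fun t ht x hx => ?_, fun t ht x hx => ?_, ?_, ?_⟩
  · exact (hgn.comp_ofLog (by linarith) hgs).continuousInK (Real.exp_pos _) hd₁
      (fun t x hx => ofLog_eq_zero (by linarith) (hgs t) hx) _
  · exact (hrn.comp_ofLog (by linarith) hrs).continuousInK (Real.exp_pos _) hd₁
      (fun t x hx => ofLog_eq_zero (by linarith) (hrs t) hx) _
  · simp only [ofLog_apply (hgle _) hx.1, ofLog_apply (hrle _) hx.1]
    rw [hvel t x hx, (hasDerivAt_ofLog (hgle t) hx.1 (hdiff hg₁ t _)).deriv]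
    refine (hF.hasDerivWithinAt_forcedTransport (hψ (n := 1)) (hcg hω₀) (hcr hρ₀) hZ₁.1 ht
      (Real.log x)).congr_deriv ?_
    rw [hr_apply, Real.exp_neg, Real.exp_log hx.1, ← hg]
    have := hx.1.ne'
    field_simp
  · simp only [ofLog_apply (hrle _) hx.1]
    rw [hvel t x hx, (hasDerivAt_ofLog (hrle t) hx.1 (hdiff hr₁ t _)).deriv]
    refine (hF.hasDerivWithinAt_forcedTransport (hψ (n := 1)) (hcr hρ₀) (r₀ := 0)
      contDiff_const hZ₁.1 ht (Real.log x)).congr_deriv ?_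
    have := hx.1.ne'
    rw [← hr]
    field_simp
    simp
  · refine (congrArg (ofLog c) (funext fun z => ?_)).trans (hzero hsω)
    simp [hg, forcedTransport, forcedLabel, hlabel, clampTime_of_mem ⟨le_rfl, hT.le⟩, hg₀]
  · refine (congrArg (ofLog c) (funext fun z => ?_)).trans (hzero hsρ)
    rw [hr_apply, hlabel]

theorem theorem1 (β₁ β₂ : ℝ) (hβ₂ : 0 < β₂) (hβ₂' : β₂ ≤ 1) (hβ₁ : 1 ≤ β₁)
    (ω₀ ρ₀ : ℝ → ℝ) (hω₀ : ∀ x, 0 ≤ ω₀ x) (hρ₀ : ∀ x, 0 ≤ ρ₀ x) :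
    ∃ T : ℝ, 0 < T ∧ ∀ n : ℕ, 1 ≤ n → MemK n ω₀ → MemK n ρ₀ →
      ∃ ω ρ : ℝ → ℝ → ℝ, IsSolution β₁ β₂ n ω₀ ρ₀ (Icc 0 T) ω ρ ∧
        ∀ J : Set ℝ, J ⊆ Icc 0 T → J.OrdConnected → (0 : ℝ) ∈ J →
          ∀ ω' ρ' : ℝ → ℝ → ℝ, IsSolution β₁ β₂ n ω₀ ρ₀ J ω' ρ' →
            ∀ t ∈ J, ω' t = ω t ∧ ρ' t = ρ t := by
  by_cases h : MemK 1 ω₀ ∧ MemK 1 ρ₀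
  · obtain ⟨T, hT, ω, ρ, hsol⟩ := exists_isSolution hβ₂ hβ₁ h.1 h.2
    refine ⟨T, hT, fun n hn hω hρ => ⟨ω, ρ, hsol n hn hω hρ, ?_⟩⟩
    intro J hJT hJ hJ₀ ω' ρ' h' t ht
    have hsub : Icc 0 t ⊆ J := hJ.out hJ₀ ht
    exact (h'.mono hsub).unique hβ₂ hβ₁ hn (hJT ht).1
      ((hsol n hn hω hρ).mono (hsub.trans hJT)) ⟨(hJT ht).1, le_rfl⟩
  -- Data outside `K^1` lie in no `K^n` with `n ≥ 1`, so any positive time will do.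
  · exact ⟨1, one_pos, fun n hn hω hρ => absurd ⟨hω.mono hn, hρ.mono hn⟩ h⟩
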